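/- Let $-\infty<\omega_*<\omega^*<+\infty$ and $T>0$. Write $(e_1,e_2,e_3)$ for the canonical basis of $\mathbb R^3$ and $\wedge$ for the cross product. Set $\epsilon(t)=(-1)^{\lfloor t/T\rfloor}$, $\sigma(t)=\int_0^t\epsilon(s)\,ds$ and $S=\begin{pmatrix}0&1&0\\-1&0&0\\0&0&0\end{pmatrix}$. Let $M_f\in H^1((\omega_*,\omega^*),\mathbb S^2)$ and let $R\in H^1((\omega_*,\omega^*),SO_3(\mathbb R))$ satisfy $R(\omega)M_f(\omega)=-e_3$ for all $\omega$. Put $F(t,\omega)=R(\omega)\exp(\sigma(t)\omega S)$ and, for $i\in\{1,2\}$ and $N\in H^1((\omega_*,\omega^*),\mathbb R^3)$, $$H_i[t,N]=\int_{\omega_*}^{\omega^*}\Big[\Big\langle \tfrac{dN}{d\omega}(\omega),\Big(\tfrac{\partial F}{\partial\omega}(t,\omega)e_i\Big)\wedge N(\omega)\Big\rangle+\Big\langle e_3,\big(F(t,\omega)e_i\big)\wedge N(\omega)\Big\rangle\Big]d\omega,\qquad u_i[t,N]=-H_i[t,N].$$ The closed-loop solution with initial condition $N(\tau)=N^0$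 is the function $N\in C^1([\tau,+\infty),H^1((\omega_*,\omega^*),\mathbb R^3))$ such that $N(\tau)=N^0$ and $$\frac{\partial N}{\partial t}(t,\omega)=\sum_{i=1}^2u_i[t,N(t)]\,\big(F(t,\omega)e_i\big)\wedge N(t,\omega),\qquad t\ge\tau.$$ Let $(N_n^0)_{n\in\mathbb N}$ be a sequence in $H^1((\omega_*,\omega^*),\mathbb S^2)$ and let $N_\infty^0\in H^1((\omega_*,\omega^*),\mathbb S^2)$ be such that $N_n^0\rightharpoonup N_\infty^0$ weakly in $H^1$ and $N_n^0\to N_\infty^0$ strongly in $L^2$. Let $\alpha\in[0,2T]$ and let $(\tau_n)_{n\in\mathbb N}$ be a sequence in $[0,2T)$ such that $\tau_n\to\alpha$. Let $N_n$ (resp. $N_\infty$) be the closed-loop solution with initial condition $N_n(\tau_n)=N_n^0$ (resp. $N_\infty(\alpha)=N_\infty^0$). Then, for every $t>\alpha$, $N_n(t)\rightharpoonup N_\infty(t)$ weakly in $H^1$, and $u_j[t,N_n(t)]\to u_j[t,N_\infty(t)]$ for every $j\in\{1,2\}$. -/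

import Mathlib

open MeasureTheory Filter Topology Set
open scoped Matrix Matrix.Norms.L2Operator

namespace BlochEnsemble

noncomputable section

/-! ## Sobolev spaces `H^1((a, b), E)` -/

/-- Lebesgue measure on the open interval `(a, b)`. -/
abbrev intervalMeasure (a b : ℝ) : Measure ℝ := volume.restrict (Ioo a b)

/-- `φ` is a real valued test function on `(a, b)`: smooth, with compact support in `(a, b)`. -/
structure IsTest (a b : ℝ) (φ : ℝ → ℝ) : Prop where
  smooth : ContDiff ℝ (⊤ : ℕ∞) φ
  compact : HasCompactSupport φ
  support : tsupport φ ⊆ Ioo a b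

/-- `g` is a weak (distributional) derivative of `f` on `(a, b)`. It is only used when `f` and `g`
are square integrable on `(a, b)`, so that all integrands are integrable. -/
def HasWeakDeriv {E : Type*} [NormedAddCommGroup E] [NormedSpace ℝ E]
    (a b : ℝ) (f g : ℝ → E) : Prop :=
  ∀ φ : ℝ → ℝ, IsTest a b φ →
    ∫ x in Ioo a b, deriv φ x • f x = - ∫ x in Ioo a b, φ x • g x

/-- The space `L^2((a, b), E)`. -/
abbrev L2 (a b : ℝ) (E : Type*) [NormedAddCommGroup E] : Type _ := Lp E 2 (intervalMeasure a b)

theorem integrable_smul_L2 {E : Type*} [NormedAddCommGroup E] [NormedSpace ℝ E] {a b : ℝ}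
    {ψ : ℝ → ℝ} (hψ : Continuous ψ) (hc : HasCompactSupport ψ) (f : L2 a b E) :
    Integrable (fun x => ψ x • f x) (intervalMeasure a b) := by
  have hf : Integrable (f : ℝ → E) (intervalMeasure a b) :=
    (Lp.memLp f).integrable (by norm_num)
  obtain ⟨C, hC⟩ := hψ.bounded_above_of_compact_support hc
  exact hf.bdd_smul C hψ.aestronglyMeasurable (Eventually.of_forall hC)

/-- `H^1((a, b), E)`, as the space of pairs `(f, f')` of elements of `L^2((a, b), E)` such that `f'`
is the weak derivative of `f`; it carries the norm `(‖f‖² + ‖f'‖²)^(1/2)`, where `‖·‖` is the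
`L^2` norm. -/
def H1Submodule (a b : ℝ) (E : Type*) [NormedAddCommGroup E] [NormedSpace ℝ E] :
    Submodule ℝ (WithLp 2 (L2 a b E × L2 a b E)) where
  carrier := {p | HasWeakDeriv a b (p.fst : ℝ → E) (p.snd : ℝ → E)}
  zero_mem' := by
    intro φ _
    have h0 : ((0 : L2 a b E) : ℝ → E) =ᵐ[intervalMeasure a b] 0 := Lp.coeFn_zero E 2 _
    have h1 : ∀ ψ : ℝ → ℝ, ∫ x in Ioo a b, ψ x • ((0 : L2 a b E) : ℝ → E) x = 0 := by
      intro ψ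
      apply integral_eq_zero_of_ae
      filter_upwards [h0] with x hx
      rw [hx, Pi.zero_apply, smul_zero]
    simp only [WithLp.zero_fst, WithLp.zero_snd]
    rw [h1, h1, neg_zero]
  add_mem' := by
    intro p q hp hq φ hφ
    have key : ∀ ψ : ℝ → ℝ, Continuous ψ → HasCompactSupport ψ → ∀ f g : L2 a b E,
        ∫ x in Ioo a b, ψ x • ((f + g : L2 a b E) : ℝ → E) x =
          (∫ x in Ioo a b, ψ x • f x) + ∫ x in Ioo a b, ψ x • g x := by
      intro ψ h1 h2 f g
      rw [← integral_add (integrable_smul_L2 h1 h2 f) (integrable_smul_L2 h1 h2 g)]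
      apply integral_congr_ae
      filter_upwards [Lp.coeFn_add f g] with x hx
      rw [hx, Pi.add_apply, smul_add]
    simp only [WithLp.add_fst, WithLp.add_snd]
    rw [key _ (hφ.smooth.continuous_deriv (by simp)) hφ.compact.deriv,
      key _ hφ.smooth.continuous hφ.compact, hp φ hφ, hq φ hφ, neg_add]
  smul_mem' := by
    intro c p hp φ hφ
    have key : ∀ (ψ : ℝ → ℝ) (f : L2 a b E),
        ∫ x in Ioo a b, ψ x • ((c • f : L2 a b E) : ℝ → E) x =
          c • ∫ x in Ioo a b, ψ x • f x := by
      intro ψ f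
      rw [← integral_smul]
      apply integral_congr_ae
      filter_upwards [Lp.coeFn_smul c f] with x hx
      simp [hx, smul_comm c]
    simp only [WithLp.smul_fst, WithLp.smul_snd]
    rw [key, key, hp φ hφ, smul_neg]

/-- The Sobolev space `H^1((a, b), E)`, a normed space. -/
abbrev H1 (a b : ℝ) (E : Type*) [NormedAddCommGroup E] [NormedSpace ℝ E] : Type _ :=
  ↥(H1Submodule a b E)

section H1

variable {a b : ℝ} {E : Type*} [NormedAddCommGroup E] [NormedSpace ℝ E]

/-- The inclusion of `H^1` into `L^2`. -/
def H1.toL2 (f : H1 a b E) : L2 a b E := f.1.fst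

/-- A representative of an element of `H^1`, defined up to equality almost everywhere. -/
def H1.fn (f : H1 a b E) : ℝ → E := f.toL2

/-- A representative of the weak derivative of an element of `H^1`. -/
def H1.dfn (f : H1 a b E) : ℝ → E := (f.1.snd : L2 a b E)

end H1

open Classical in
/-- The weak derivative of a function in `H^1((a, b), E)`, unique up to equality almost everywhere
(and `0` when `f` has no square integrable weak derivative). -/
def weakDeriv {E : Type*} [NormedAddCommGroup E] [NormedSpace ℝ E] (a b : ℝ) (f : ℝ → E) : ℝ → E :=
  if h : ∃ g : ℝ → E, MemLp g 2 (intervalMeasure a b) ∧ HasWeakDeriv a b f g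
  then Classical.choose h else 0

/-- Weak convergence of a sequence in a normed space: convergence against every continuous linear
functional. -/
def WeaklyTendsto {X : Type*} [NormedAddCommGroup X] [NormedSpace ℝ X]
    (x : ℕ → X) (y : X) : Prop :=
  ∀ l : X →L[ℝ] ℝ, Tendsto (fun n => l (x n)) atTop (𝓝 (l y))

/-! ## The space `ℝ³` and matrices -/

/-- Euclidean space of dimension three. -/
abbrev E3 : Type := EuclideanSpace ℝ (Fin 3)

/-- Real `3 × 3` matrices, with the operator norm associated with the Euclidean norm. -/
abbrev Mat3 : Type := Matrix (Fin 3) (Fin 3) ℝ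

/-- The canonical basis `e_1, e_2, e_3` (indexed from `0`). -/
def e (i : Fin 3) : E3 := EuclideanSpace.single i 1

/-- The wedge (cross) product on `ℝ³`. -/
def wedge (v w : E3) : E3 := WithLp.toLp 2 (v.ofLp ⨯₃ w.ofLp)

/-- The action of a matrix on a vector. -/
def act (A : Mat3) (v : E3) : E3 := WithLp.toLp 2 (A *ᵥ v.ofLp)

/-- The matrix of `v ↦ - e_3 ∧ v`. -/
def S : Mat3 := !![0, 1, 0; -1, 0, 0; 0, 0, 0]

/-- A profile in `H^1((a, b), ℝ³)` takes its values in the unit sphere. -/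
def SphereValued {a b : ℝ} (N : H1 a b E3) : Prop :=
  ∀ᵐ ω ∂(intervalMeasure a b), ‖N.fn ω‖ = 1

/-- A profile in `H^1((a, b), M_3(ℝ))` takes its values in `SO(3)`. -/
def RotationValued {a b : ℝ} (R : H1 a b Mat3) : Prop :=
  ∀ᵐ ω ∂(intervalMeasure a b), R.fn ω ∈ Matrix.specialOrthogonalGroup (Fin 3) ℝ

/-! ## The closed loop system -/

/-- `ε(t) = (-1)^⌊t / T⌋`. -/
def eps (T t : ℝ) : ℝ := (-1 : ℝ) ^ ⌊t / T⌋

/-- `σ(t) = ∫_0^t ε(s) ds`. -/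
def sigma (T t : ℝ) : ℝ := ∫ s in (0 : ℝ)..t, eps T s

section System

variable {a b : ℝ}

/-- `F(t, ω) = R(ω) exp(σ(t) ω S)`. -/
def F (T : ℝ) (R : H1 a b Mat3) (t ω : ℝ) : Mat3 :=
  R.fn ω * NormedSpace.exp ((sigma T t * ω) • S)

/-- `∂F/∂ω(t, ω)`, the weak derivative with respect to `ω`. -/
def dF (T : ℝ) (R : H1 a b Mat3) (t : ℝ) : ℝ → Mat3 :=
  weakDeriv a b (F T R t)

/-- `H_i[t, N] = ∫ ⟨N'(ω), (∂F/∂ω(t, ω) e_i) ∧ N(ω)⟩ + ⟨e_3, (F(t, ω) e_i) ∧ N(ω)⟩ dω`. -/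
def H (T : ℝ) (R : H1 a b Mat3) (i : Fin 2) (t : ℝ) (N : H1 a b E3) : ℝ :=
  ∫ ω in Ioo a b,
    (inner ℝ (N.dfn ω) (wedge (act (dF T R t ω) (e i.castSucc)) (N.fn ω)) +
      inner ℝ (e 2) (wedge (act (F T R t ω) (e i.castSucc)) (N.fn ω)))

/-- The feedback law `u_i[t, N] = - H_i[t, N]`, `i = 1, 2` (indexed from `0`). -/
def u (T : ℝ) (R : H1 a b Mat3) (i : Fin 2) (t : ℝ) (N : H1 a b E3) : ℝ :=
  - H T R i t N

/-- `N` is a solution in `C^1([τ, ∞), H^1((a, b), ℝ³))` of the closed loop system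
`∂N/∂t = ∑ u_i[t, N(t)] (F(t, ω) e_i) ∧ N` on `[τ, ∞)`, with `N(τ) = N0`. The values of `N` at times
before `τ` are irrelevant. -/
structure IsClosedLoopSolution (T : ℝ) (R : H1 a b Mat3) (τ : ℝ) (N0 : H1 a b E3)
    (N : ℝ → H1 a b E3) : Prop where
  contDiffOn : ContDiffOn ℝ 1 N (Ici τ)
  initial : N τ = N0
  equation : ∀ t ∈ Ici τ, ∀ᵐ ω ∂(intervalMeasure a b),
    (derivWithin N (Ici τ) t : H1 a b E3).fn ω =
      ∑ i : Fin 2, u T R i t (N t) • wedge (act (F T R t ω) (e i.castSucc)) ((N t).fn ω)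

end System

end

end BlochEnsemble

open BlochEnsemble

/-!
The closed loop system is an ordinary differential equation in the Hilbert space
`X = H^1((a, b), ℝ³)`,
`N' = ∑ i, u_i(t, N) • A_i(t) N`, where `A_i(t) N = (F(t, ·) e_i) ∧ N` is a bounded operator on `X`
which depends continuously on `t`, and where `u_i(t, N)` is a bounded quadratic form in `N` plus a
bounded linear form. It differs from a generic equation of this type in two respects.

* The quadratic part `-∫ ⟨N', (∂F/∂ω e_i) ∧ N⟩` is compact in its undifferentiated argument:
  if `x_n ⇀ 0` weakly in `H^1`, then `x_n` is bounded and tends to `0` pointwise, hence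
  `(∂F/∂ω e_i) ∧ x_n → 0` in `L^2` by dominated convergence (`H1.tendsto_mulL2_zero`). So the
  feedback laws are weakly sequentially continuous.
* The `L^2` norm of `N` is conserved, and `½ ∫ |N'|² + ∫ ⟨e_3, N⟩` has derivative `-∑ i, u_i²` along
  the solutions, so that these stay bounded in `H^1` (`exists_norm_le_of_isSolution`).

With these two facts, weak convergence follows from Grönwall's inequality, without extracting
subsequences (`FeedbackSystem.IsSolution.weaklyTendsto_step`). The difference `E_n = N_n - N_∞`
satisfies `E_n' = A_∞(t) E_n + ∑ i, (u_i(t, N_n) - u_i(t, N_∞)) • A_i(t) N_n`, where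
`A_∞(t) = ∑ i, u_i(t, N_∞(t)) • A_i(t)`. Let `V(t)` be the propagator of `A_∞` and write
`E_n(t) = V(t) E_n⁰ + y_n(t)`, with `E_n⁰` the weakly null initial difference. As `V(t)` is
a bounded operator, `V(t) E_n⁰ ⇀ 0`, and therefore
`|u_i(t, N_n) - u_i(t, N_∞)| ≤ o_n(t) + C ‖y_n(t)‖`, where `o_n` is bounded and tends to `0`
pointwise. So `‖y_n'‖ ≤ C (‖y_n‖ + o_n)`, and `y_n → 0` in norm, whence `E_n ⇀ 0`.
Picard–Lindelöf provides `V` on intervals whose length is bounded from below, and finitely many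
steps reach any given time.

The calculus in `H^1` rests on the absolutely continuous representative of a function with an
integrable weak derivative (`HasWeakDeriv.exists_isPrimitiveOn`). It makes the values of the
function continuous linear functionals on `H^1`, and yields the product rule, by Fubini's theorem.
-/

namespace BlochEnsemble

noncomputable section

/-! ### Primitives and weak derivatives on an interval -/

section Primitive

variable {E F G : Type*} [NormedAddCommGroup E] [NormedSpace ℝ E]
  [NormedAddCommGroup F] [NormedSpace ℝ F] [NormedAddCommGroup G] [NormedSpace ℝ G]

/-- `F` is a primitive on `[a, b]` of the integrable function `f`, that is, `F` is absolutely
continuous with derivative `f`; the constant of integration is `F a`. -/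
structure IsPrimitiveOn (a b : ℝ) (F f : ℝ → E) : Prop where
  integrable : IntegrableOn f (Ioc a b)
  eq : ∀ x ∈ Icc a b, F x = F a + ∫ s in Ioc a x, f s

/-- Integration by parts for the primitives which vanish at `a`: Fubini's theorem on the square
`(a, x]²`, cut along its diagonal. -/
theorem bilin_setIntegral [CompleteSpace E] [CompleteSpace F] [CompleteSpace G]
    (B : E →L[ℝ] F →L[ℝ] G) {a x : ℝ} {f : ℝ → E} {g : ℝ → F}
    (hf : IntegrableOn f (Ioc a x)) (hg : IntegrableOn g (Ioc a x)) :
    IntegrableOn (fun s => B (f s) (∫ t in Ioc a s, g t)) (Ioc a x) ∧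
    IntegrableOn (fun s => B (∫ t in Ioc a s, f t) (g s)) (Ioc a x) ∧
    B (∫ s in Ioc a x, f s) (∫ s in Ioc a x, g s) =
      (∫ s in Ioc a x, B (f s) (∫ t in Ioc a s, g t)) +
        ∫ s in Ioc a x, B (∫ t in Ioc a s, f t) (g s) := by
  set μ : Measure ℝ := volume.restrict (Ioc a x) with hμ
  have hk : Integrable (fun p : ℝ × ℝ => B (f p.1) (g p.2)) (μ.prod μ) :=
    Integrable.op_fst_snd (op := fun u v => B u v) (by fun_prop) ⟨‖B‖, B.le_opNorm₂⟩ hf hg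
  have hD : MeasurableSet {p : ℝ × ℝ | p.2 ≤ p.1} := measurableSet_le measurable_snd measurable_fst
  have h1 := hk.indicator hD
  have h2 := hk.indicator hD.compl
  have e1 : ∀ s ∈ Ioc a x, (∫ t, ({p : ℝ × ℝ | p.2 ≤ p.1}.indicator
      (fun p : ℝ × ℝ => B (f p.1) (g p.2)) (s, t)) ∂μ) = B (f s) (∫ t in Ioc a s, g t) := by
    intro s hs
    have : (fun t => ({p : ℝ × ℝ | p.2 ≤ p.1}.indicator
      (fun p : ℝ × ℝ => B (f p.1) (g p.2)) (s, t))) =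
        (Iic s).indicator (fun t => B (f s) (g t)) := by
      ext t; simp [indicator]
    rw [this, integral_indicator measurableSet_Iic, hμ, Measure.restrict_restrict measurableSet_Iic]
    have hset : Iic s ∩ Ioc a x = Ioc a s := by
      ext t; simp only [mem_inter_iff, mem_Iic, mem_Ioc]
      constructor
      · rintro ⟨h, h', -⟩; exact ⟨h', h⟩
      · rintro ⟨h, h'⟩; exact ⟨h', h, h'.trans hs.2⟩
    rw [hset]
    exact (B (f s)).integral_comp_comm (hg.mono_set (Ioc_subset_Ioc_right hs.2))
  have e2 : ∀ t ∈ Ioc a x, (∫ s, ({p : ℝ × ℝ | p.2 ≤ p.1}ᶜ.indicator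
      (fun p : ℝ × ℝ => B (f p.1) (g p.2)) (s, t)) ∂μ) = B (∫ s in Ioc a t, f s) (g t) := by
    intro t ht
    have : (fun s => ({p : ℝ × ℝ | p.2 ≤ p.1}ᶜ.indicator
      (fun p : ℝ × ℝ => B (f p.1) (g p.2)) (s, t))) =
        (Iio t).indicator (fun s => B.flip (g t) (f s)) := by
      ext s; simp [indicator]
    rw [this, integral_indicator measurableSet_Iio, hμ, Measure.restrict_restrict measurableSet_Iio]
    have hset : Iio t ∩ Ioc a x = Ioo a t := by
      ext s; simp only [mem_inter_iff, mem_Iio, mem_Ioc, mem_Ioo]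
      constructor
      · rintro ⟨h, h', -⟩; exact ⟨h', h⟩
      · rintro ⟨h, h'⟩; exact ⟨h', h, h'.le.trans ht.2⟩
    rw [hset, ← integral_Ioc_eq_integral_Ioo]
    exact (B.flip (g t)).integral_comp_comm (hf.mono_set (Ioc_subset_Ioc_right ht.2))
  have i1 := h1.integral_prod_left
  have i2 := h2.swap.integral_prod_left
  have e1' : (fun s => ∫ t, ({p : ℝ × ℝ | p.2 ≤ p.1}.indicator
      (fun p : ℝ × ℝ => B (f p.1) (g p.2)) (s, t)) ∂μ) =ᵐ[μ]
      fun s => B (f s) (∫ t in Ioc a s, g t) :=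
    (ae_restrict_mem measurableSet_Ioc).mono e1
  have e2' : (fun t => ∫ s, ({p : ℝ × ℝ | p.2 ≤ p.1}ᶜ.indicator
      (fun p : ℝ × ℝ => B (f p.1) (g p.2)) (s, t)) ∂μ) =ᵐ[μ]
      fun t => B (∫ s in Ioc a t, f s) (g t) :=
    (ae_restrict_mem measurableSet_Ioc).mono e2
  refine ⟨i1.congr e1', i2.congr e2', ?_⟩
  have key : ∫ p, B (f p.1) (g p.2) ∂(μ.prod μ) = B (∫ s, f s ∂μ) (∫ s, g s ∂μ) := by
    rw [integral_prod _ hk]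
    have : ∀ s, ∫ t, B (f s) (g t) ∂μ = B.flip (∫ t, g t ∂μ) (f s) := fun s =>
      (B (f s)).integral_comp_comm hg
    simp only [this]
    exact (B.flip _).integral_comp_comm hf
  rw [← key, ← integral_congr_ae e1', ← integral_congr_ae e2', ← integral_prod _ h1,
    ← integral_prod_symm _ h2, ← integral_add h1 h2]
  refine integral_congr_ae (Eventually.of_forall fun p => ?_)
  exact (congrFun (indicator_self_add_compl {p : ℝ × ℝ | p.2 ≤ p.1}
    (fun p : ℝ × ℝ => B (f p.1) (g p.2))) p).symm

theorem IsPrimitiveOn.mono_right {a b : ℝ} {F f : ℝ → E} (h : IsPrimitiveOn a b F f) {x : ℝ}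
    (hx : x ≤ b) : IsPrimitiveOn a x F f :=
  ⟨h.integrable.mono_set (Ioc_subset_Ioc_right hx), fun y hy => h.eq y ⟨hy.1, hy.2.trans hx⟩⟩

/-- The product rule for absolutely continuous functions. -/
theorem IsPrimitiveOn.bilin [CompleteSpace E] [CompleteSpace F] [CompleteSpace G]
    (B : E →L[ℝ] F →L[ℝ] G) {a b : ℝ} {u f : ℝ → E} {v g : ℝ → F}
    (hu : IsPrimitiveOn a b u f) (hv : IsPrimitiveOn a b v g) :
    IsPrimitiveOn a b (fun x => B (u x) (v x)) (fun x => B (f x) (v x) + B (u x) (g x)) := by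
  have key : ∀ x ∈ Icc a b,
      IntegrableOn (fun x => B (f x) (v x) + B (u x) (g x)) (Ioc a x) ∧
      B (u x) (v x) = B (u a) (v a) + ∫ s in Ioc a x, (B (f s) (v s) + B (u s) (g s)) := by
    intro x hx
    have hf := (hu.mono_right hx.2).integrable
    have hg := (hv.mono_right hx.2).integrable
    obtain ⟨i1, i2, h⟩ := bilin_setIntegral B hf hg
    have j1 : IntegrableOn (fun s => B (f s) (v a)) (Ioc a x) :=
      (B.flip (v a)).integrable_comp hf
    have j2 : IntegrableOn (fun s => B (u a) (g s)) (Ioc a x) := (B (u a)).integrable_comp hg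
    have hae : (fun s => B (f s) (v s) + B (u s) (g s)) =ᵐ[volume.restrict (Ioc a x)] fun s =>
        (B (f s) (v a) + B (f s) (∫ t in Ioc a s, g t)) +
          (B (u a) (g s) + B (∫ t in Ioc a s, f t) (g s)) := by
      filter_upwards [ae_restrict_mem measurableSet_Ioc] with s hs
      have hs' : s ∈ Icc a b := ⟨hs.1.le, hs.2.trans hx.2⟩
      rw [hu.eq s hs', hv.eq s hs']
      simp
    have s1 : IntegrableOn (fun s => B (f s) (v a) + B (f s) (∫ t in Ioc a s, g t)) (Ioc a x) :=
      j1.add i1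
    have s2 : IntegrableOn (fun s => B (u a) (g s) + B (∫ t in Ioc a s, f t) (g s)) (Ioc a x) :=
      j2.add i2
    refine ⟨(s1.add s2).congr hae.symm, ?_⟩
    rw [integral_congr_ae hae, integral_add s1 s2, integral_add j1 i1, integral_add j2 i2,
      hu.eq x hx, hv.eq x hx]
    have k1 : ∫ s in Ioc a x, B (f s) (v a) = B (∫ s in Ioc a x, f s) (v a) :=
      (B.flip (v a)).integral_comp_comm hf
    have k2 : ∫ s in Ioc a x, B (u a) (g s) = B (u a) (∫ s in Ioc a x, g s) :=
      (B (u a)).integral_comp_comm hg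
    rw [k1, k2]
    simp only [map_add, add_apply, h]
    abel
  rcases le_or_gt a b with hab | hab
  · exact ⟨(key b ⟨hab, le_rfl⟩).1, fun x hx => (key x hx).2⟩
  · exact ⟨by simp [Ioc_eq_empty hab.le.not_gt], fun x hx => absurd (hx.1.trans hx.2) hab.not_ge⟩

theorem isPrimitiveOn_of_contDiff [CompleteSpace E] {F : ℝ → E} (hF : ContDiff ℝ 1 F) (a b : ℝ) :
    IsPrimitiveOn a b F (deriv F) := by
  have hc : Continuous (deriv F) := hF.continuous_deriv le_rfl
  refine ⟨(hc.integrableOn_Icc).mono_set Ioc_subset_Icc_self, fun x hx => ?_⟩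
  rw [← intervalIntegral.integral_of_le hx.1, intervalIntegral.integral_deriv_eq_sub
    (fun y _ => (hF.differentiable one_ne_zero).differentiableAt) (hc.intervalIntegrable _ _)]
  abel

/-- A primitive of `f` has `f` as weak derivative. -/
theorem IsPrimitiveOn.hasWeakDeriv [CompleteSpace E] {a b : ℝ} (hab : a < b) {u f : ℝ → E}
    (hu : IsPrimitiveOn a b u f) : HasWeakDeriv a b u f := by
  intro φ hφ
  have hsm : ContDiff ℝ 1 φ := hφ.smooth.of_le (by exact_mod_cast le_top)
  have h := (isPrimitiveOn_of_contDiff hsm a b).bilin (ContinuousLinearMap.lsmul ℝ ℝ) hu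
  have ha : φ a = 0 := image_eq_zero_of_notMem_tsupport fun h => (hφ.support h).1.false
  have hb : φ b = 0 := image_eq_zero_of_notMem_tsupport fun h => (hφ.support h).2.false
  have h1 := h.eq b ⟨hab.le, le_rfl⟩
  simp only [ContinuousLinearMap.lsmul_apply, ha, hb, zero_smul, zero_add] at h1
  have i2 : IntegrableOn (fun s => φ s • f s) (Ioc a b) := by
    obtain ⟨C, hC⟩ := hφ.smooth.continuous.bounded_above_of_compact_support hφ.compact
    exact hu.integrable.bdd_smul C hφ.smooth.continuous.aestronglyMeasurable
      (Eventually.of_forall hC)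
  have i1 : IntegrableOn (fun s => deriv φ s • u s) (Ioc a b) := by
    have := h.integrable.sub i2
    refine this.congr (Eventually.of_forall fun s => ?_)
    simp
  rw [integral_add i1 i2] at h1
  rw [← integral_Ioc_eq_integral_Ioo, ← integral_Ioc_eq_integral_Ioo]
  exact eq_neg_of_add_eq_zero_left h1.symm

theorem ae_eq_zero_of_forall_test [CompleteSpace E] {a b : ℝ} {f : ℝ → E}
    (hf : IntegrableOn f (Ioo a b))
    (h : ∀ φ, IsTest a b φ → ∫ x in Ioo a b, φ x • f x = 0) :
    ∀ᵐ x ∂(intervalMeasure a b), f x = 0 := by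
  rw [ae_restrict_iff' measurableSet_Ioo]
  refine isOpen_Ioo.ae_eq_zero_of_integral_contDiff_smul_eq_zero hf.locallyIntegrableOn ?_
  intro g h1 h2 h3
  rw [← h g ⟨h1, h2, h3⟩]
  refine (setIntegral_eq_integral_of_forall_compl_eq_zero fun x hx => ?_).symm
  rw [image_eq_zero_of_notMem_tsupport fun h => hx (h3 h), zero_smul]

theorem IsTest.integrable_smul {a b : ℝ} {φ : ℝ → ℝ} (hφ : IsTest a b φ) {f : ℝ → E}
    {s : Set ℝ} (hf : IntegrableOn f s) : IntegrableOn (fun x => φ x • f x) s := by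
  obtain ⟨C, hC⟩ := hφ.smooth.continuous.bounded_above_of_compact_support hφ.compact
  exact hf.bdd_smul C hφ.smooth.continuous.aestronglyMeasurable (Eventually.of_forall hC)

theorem HasWeakDeriv.unique [CompleteSpace E] {a b : ℝ} {f g g' : ℝ → E}
    (hg : IntegrableOn g (Ioo a b)) (hg' : IntegrableOn g' (Ioo a b))
    (h : HasWeakDeriv a b f g) (h' : HasWeakDeriv a b f g') :
    g =ᵐ[intervalMeasure a b] g' := by
  have := ae_eq_zero_of_forall_test (hg.sub hg') fun φ hφ => by
    simp only [Pi.sub_apply, smul_sub]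
    rw [integral_sub (hφ.integrable_smul hg) (hφ.integrable_smul hg'), sub_eq_zero]
    exact neg_injective ((h φ hφ).symm.trans (h' φ hφ))
  filter_upwards [this] with x hx using sub_eq_zero.1 hx

theorem IsTest.integrable {a b : ℝ} {φ : ℝ → ℝ} (hφ : IsTest a b φ) : Integrable φ :=
  hφ.smooth.continuous.integrable_of_hasCompactSupport hφ.compact

theorem IsTest.setIntegral_eq {a b : ℝ} {φ : ℝ → ℝ} (hφ : IsTest a b φ) :
    ∫ x in Ioo a b, φ x = ∫ x, φ x :=
  setIntegral_eq_integral_of_forall_compl_eq_zero fun _ hx =>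
    image_eq_zero_of_notMem_tsupport fun h => hx (hφ.support h)

/-- A test function of integral zero is the derivative of a test function. -/
theorem IsTest.exists_deriv_eq {a b : ℝ} {ψ : ℝ → ℝ} (hψ : IsTest a b ψ)
    (h0 : ∫ x, ψ x = 0) : ∃ φ, IsTest a b φ ∧ deriv φ = ψ := by
  rcases (tsupport ψ).eq_empty_or_nonempty with he | hne
  · refine ⟨ψ, hψ, ?_⟩
    rw [tsupport_eq_empty_iff] at he
    subst he
    ext x
    simp
  obtain ⟨c, hc⟩ := hψ.compact.exists_isLeast hne
  obtain ⟨d, hd⟩ := hψ.compact.exists_isGreatest hne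
  have hz : ∀ x, x ∉ Icc c d → ψ x = 0 := fun x hx =>
    image_eq_zero_of_notMem_tsupport fun h => hx ⟨hc.2 h, hd.2 h⟩
  have hder : ∀ x, HasDerivAt (fun x => ∫ s in Iic x, ψ s) (ψ x) x := by
    intro x
    have h1 : HasDerivAt (fun x => (∫ s in (0 : ℝ)..x, ψ s) + ∫ s in Iic (0 : ℝ), ψ s) (ψ x) x :=
      (intervalIntegral.integral_hasDerivAt_right
        (hψ.smooth.continuous.intervalIntegrable _ _)
        (hψ.smooth.continuous.stronglyMeasurableAtFilter _ _)
        hψ.smooth.continuous.continuousAt).add_const _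
    refine h1.congr_of_eventuallyEq (Eventually.of_forall fun y => ?_)
    have := intervalIntegral.integral_Iic_sub_Iic (hψ.integrable.integrableOn (s := Iic (0 : ℝ)))
      (hψ.integrable.integrableOn (s := Iic y))
    simp only [← this]
    abel
  have hderiv : deriv (fun x => ∫ s in Iic x, ψ s) = ψ := funext fun x => (hder x).deriv
  have hsupp : tsupport (fun x => ∫ s in Iic x, ψ s) ⊆ Icc c d := by
    refine closure_minimal (fun x hx => ?_) isClosed_Icc
    by_contra hcd
    apply hx
    rcases lt_or_ge x c with hxc | hxc
    · exact setIntegral_eq_zero_of_forall_eq_zero fun y hy =>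
        hz y fun h => (h.1.trans hy).not_gt hxc
    · have hdx : d < x := not_le.1 fun h => hcd ⟨hxc, h⟩
      simp only
      rw [← h0]
      refine setIntegral_eq_integral_of_forall_compl_eq_zero fun y hy => hz y fun h => hy ?_
      exact h.2.trans hdx.le
  refine ⟨_, ⟨?_, ?_, ?_⟩, hderiv⟩
  · rw [contDiff_infty_iff_deriv, hderiv]
    exact ⟨fun x => (hder x).differentiableAt, hψ.smooth⟩
  · exact isCompact_Icc.of_isClosed_subset (isClosed_tsupport _) hsupp
  · exact hsupp.trans fun x hx =>
      ⟨(hψ.support hc.1).1.trans_le hx.1, hx.2.trans_lt (hψ.support hd.1).2⟩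

theorem exists_isTest_integral_eq_one {a b : ℝ} (hab : a < b) :
    ∃ χ, IsTest a b χ ∧ ∫ x, χ x = 1 := by
  let f : ContDiffBump ((a + b) / 2) := ⟨(b - a) / 8, (b - a) / 4, by linarith, by linarith⟩
  refine ⟨f.normed volume, ⟨f.contDiff_normed, f.hasCompactSupport_normed, ?_⟩,
    f.integral_normed⟩
  rw [f.tsupport_normed_eq, Real.closedBall_eq_Icc]
  intro x hx
  have h1 : (a + b) / 2 - (b - a) / 4 ≤ x := hx.1
  have h2 : x ≤ (a + b) / 2 + (b - a) / 4 := hx.2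
  exact ⟨by linarith, by linarith⟩

/-- A function whose weak derivative vanishes is constant (the du Bois-Reymond lemma). -/
theorem exists_const_of_hasWeakDeriv_zero [CompleteSpace E] {a b : ℝ} (hab : a < b) {f : ℝ → E}
    (hf : IntegrableOn f (Ioo a b)) (h : HasWeakDeriv a b f 0) :
    ∃ c, ∀ᵐ x ∂(intervalMeasure a b), f x = c := by
  obtain ⟨χ, hχ, hχ1⟩ := exists_isTest_integral_eq_one hab
  have hc : IntegrableOn (fun _ : ℝ => ∫ x in Ioo a b, χ x • f x) (Ioo a b) :=
    integrableOn_const (by simp)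
  refine ⟨∫ x in Ioo a b, χ x • f x, ?_⟩
  have := ae_eq_zero_of_forall_test (hf.sub hc) fun ψ hψ => ?_
  · filter_upwards [this] with x hx using sub_eq_zero.1 hx
  -- subtracting a multiple of `χ` makes the integral of `ψ` vanish
  have hψ0 : IsTest a b (fun x => ψ x - (∫ y, ψ y) * χ x) := by
    refine ⟨hψ.smooth.sub (contDiff_const.mul hχ.smooth), ?_, ?_⟩
    · exact hψ.compact.sub (hχ.compact.mul_left)
    · exact (tsupport_sub _ _).trans (union_subset hψ.support
        ((tsupport_mul_subset_right).trans hχ.support))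
  obtain ⟨φ, hφ, hφψ⟩ := hψ0.exists_deriv_eq (by
    rw [integral_sub hψ.integrable (hχ.integrable.const_mul _), integral_const_mul, hχ1]
    ring)
  have h1 := h φ hφ
  simp only [hφψ, Pi.zero_apply, smul_zero, integral_zero, neg_zero, sub_smul, mul_smul] at h1
  rw [integral_sub (g := fun x => (∫ y, ψ y) • χ x • f x) (hψ.integrable_smul hf)
    ((hχ.integrable_smul hf).smul _), integral_smul] at h1
  simp only [Pi.sub_apply, smul_sub]
  rw [integral_sub (hψ.integrable_smul hf) (hψ.integrable_smul hc), integral_smul_const,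
    hψ.setIntegral_eq, h1]

/-- A function with an integrable weak derivative is almost everywhere equal to a primitive of
that derivative. -/
theorem HasWeakDeriv.exists_isPrimitiveOn [CompleteSpace E] {a b : ℝ} (hab : a < b) {f g : ℝ → E}
    (hf : IntegrableOn f (Ioo a b)) (hg : IntegrableOn g (Ioo a b)) (h : HasWeakDeriv a b f g) :
    ∃ u, IsPrimitiveOn a b u g ∧ f =ᵐ[intervalMeasure a b] u := by
  have hg' : IntegrableOn g (Ioc a b) := (integrableOn_Ioc_iff_integrableOn_Ioo).2 hg
  have hprim : ∀ c : E, IsPrimitiveOn a b (fun x => c + ∫ s in Ioc a x, g s) g := fun c =>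
    ⟨hg', fun x _ => by simp⟩
  have hw := (hprim 0).hasWeakDeriv hab
  have hi : IntegrableOn (fun x => 0 + ∫ s in Ioc a x, g s) (Ioo a b) := by
    have h1 := (intervalIntegral.continuousOn_primitive
      ((integrableOn_Icc_iff_integrableOn_Ioc).2 hg')).integrableOn_Icc (μ := volume)
    simpa using h1.mono_set Ioo_subset_Icc_self
  obtain ⟨c, hc⟩ := exists_const_of_hasWeakDeriv_zero hab (hf.sub hi) fun φ hφ => by
    simp only [Pi.sub_apply, smul_sub, Pi.zero_apply, smul_zero, integral_zero, neg_zero]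
    have hd : IsTest a b (deriv φ) :=
      ⟨(contDiff_infty_iff_deriv.1 hφ.smooth).2, hφ.compact.deriv,
        (closure_minimal support_deriv_subset (isClosed_tsupport _)).trans hφ.support⟩
    rw [integral_sub (hd.integrable_smul hf) (hd.integrable_smul hi), h φ hφ, hw φ hφ, sub_self]
  refine ⟨_, hprim c, ?_⟩
  filter_upwards [hc] with x hx
  rw [← hx]
  simp

end Primitive

/-! ### The Sobolev space `H^1` -/

theorem memLp_two_of_continuous {a b : ℝ} {E : Type*} [NormedAddCommGroup E] {f : ℝ → E}
    (hf : Continuous f) : MemLp f 2 (intervalMeasure a b) := by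
  obtain ⟨C, hC⟩ := isCompact_Icc.exists_bound_of_continuousOn (hf.continuousOn (s := Icc a b))
  refine MemLp.of_bound hf.aestronglyMeasurable C ?_
  filter_upwards [ae_restrict_mem measurableSet_Ioo] with x hx
  exact hC x (Ioo_subset_Icc_self hx)

theorem integrableOn_L2 {a b : ℝ} {E : Type*} [NormedAddCommGroup E] (f : L2 a b E) :
    IntegrableOn f (Ioo a b) :=
  (Lp.memLp f).integrable (by norm_num)

section Sobolev

variable {a b : ℝ} {E F G : Type*} [NormedAddCommGroup E] [NormedSpace ℝ E]
  [NormedAddCommGroup F] [NormedSpace ℝ F] [NormedAddCommGroup G] [NormedSpace ℝ G]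

/-- The inclusion of `H^1` into `L^2`, as a continuous linear map. -/
def H1.toL2L : H1 a b E →L[ℝ] L2 a b E :=
  (WithLp.fstL 2 ℝ (L2 a b E) (L2 a b E)).comp (H1Submodule a b E).subtypeL

/-- The weak derivative, as a continuous linear map from `H^1` to `L^2`. -/
def H1.derivL : H1 a b E →L[ℝ] L2 a b E :=
  (WithLp.sndL 2 ℝ (L2 a b E) (L2 a b E)).comp (H1Submodule a b E).subtypeL

theorem H1.coeFn_toL2L (f : H1 a b E) : (H1.toL2L f : ℝ → E) = f.fn := rfl

theorem H1.coeFn_derivL (f : H1 a b E) : (H1.derivL f : ℝ → E) = f.dfn := rfl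

theorem H1.norm_sq_eq (f : H1 a b E) : ‖f‖ ^ 2 = ‖H1.toL2L f‖ ^ 2 + ‖H1.derivL f‖ ^ 2 :=
  WithLp.prod_norm_sq_eq_of_L2 f.1

theorem H1.hasWeakDeriv (f : H1 a b E) : HasWeakDeriv a b f.fn f.dfn := f.2

theorem HasWeakDeriv.congr {f f' g g' : ℝ → E} (h : HasWeakDeriv a b f g)
    (hf : f =ᵐ[intervalMeasure a b] f') (hg : g =ᵐ[intervalMeasure a b] g') :
    HasWeakDeriv a b f' g' := by
  intro φ hφ
  have h1 : ∫ x in Ioo a b, deriv φ x • f x = ∫ x in Ioo a b, deriv φ x • f' x :=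
    integral_congr_ae (hf.mono fun x hx => by simp only [hx])
  have h2 : ∫ x in Ioo a b, φ x • g x = ∫ x in Ioo a b, φ x • g' x :=
    integral_congr_ae (hg.mono fun x hx => by simp only [hx])
  rw [← h1, ← h2, h φ hφ]

/-- A function of `H^1` is determined by its values almost everywhere. -/
theorem H1.ext_ae [CompleteSpace E] {f g : H1 a b E}
    (h : f.fn =ᵐ[intervalMeasure a b] g.fn) : f = g := by
  apply Subtype.ext
  refine WithLp.ofLp_injective 2 (Prod.ext (Lp.ext h) (Lp.ext ?_))
  exact HasWeakDeriv.unique (integrableOn_L2 _) (integrableOn_L2 _)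
    (f.hasWeakDeriv.congr h EventuallyEq.rfl) g.hasWeakDeriv

/-- Any weak derivative, and in particular `weakDeriv`, of a representative of `f` represents the
weak derivative of `f`. -/
theorem H1.weakDeriv_ae_eq [CompleteSpace E] (f : H1 a b E) {g : ℝ → E}
    (h : g =ᵐ[intervalMeasure a b] f.fn) : weakDeriv a b g =ᵐ[intervalMeasure a b] f.dfn := by
  have hex : ∃ g' : ℝ → E, MemLp g' 2 (intervalMeasure a b) ∧ HasWeakDeriv a b g g' :=
    ⟨f.dfn, Lp.memLp _, f.hasWeakDeriv.congr h.symm EventuallyEq.rfl⟩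
  rw [weakDeriv, dif_pos hex]
  obtain ⟨h1, h2⟩ := Classical.choose_spec hex
  exact HasWeakDeriv.unique (h1.integrable (by norm_num)) (integrableOn_L2 _)
    (h2.congr h EventuallyEq.rfl) f.hasWeakDeriv

/-- The map `f ↦ ∫ ψ f` on `L^2`. -/
def integralL (a b : ℝ) (E : Type*) [NormedAddCommGroup E] [NormedSpace ℝ E] [CompleteSpace E]
    (ψ : L2 a b ℝ) : L2 a b E →L[ℝ] E :=
  (ContinuousLinearMap.lsmul ℝ ℝ).lpPairing (intervalMeasure a b) 2 2 ψ

theorem integralL_toLp [CompleteSpace E] {ψ : ℝ → ℝ} (hψ : MemLp ψ 2 (intervalMeasure a b))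
    (f : L2 a b E) : integralL a b E (hψ.toLp ψ) f = ∫ x in Ioo a b, ψ x • f x := by
  rw [integralL, ContinuousLinearMap.lpPairing_eq_integral]
  refine integral_congr_ae ?_
  filter_upwards [hψ.coeFn_toLp] with x hx
  simp [hx]

theorem memLp_indicator_one (ω : ℝ) :
    MemLp ((Iic ω).indicator fun _ => (1 : ℝ)) 2 (intervalMeasure a b) :=
  (memLp_const 1).indicator measurableSet_Iic

/-- `H^1((a, b), E)` is closed in the product of two copies of `L^2`. -/
instance H1.completeSpace [CompleteSpace E] : CompleteSpace (H1 a b E) := by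
  have hset : (H1Submodule a b E : Set (WithLp 2 (L2 a b E × L2 a b E))) =
      ⋂ (φ : ℝ → ℝ) (_ : IsTest a b φ), {p | ∫ x in Ioo a b, deriv φ x • p.fst x =
        - ∫ x in Ioo a b, φ x • p.snd x} := by
    ext p
    simp only [mem_iInter]
    exact Iff.rfl
  have hcl : IsClosed (H1Submodule a b E : Set (WithLp 2 (L2 a b E × L2 a b E))) := by
    rw [hset]
    refine isClosed_iInter fun φ => isClosed_iInter fun hφ => ?_
    simp only [← integralL_toLp (memLp_two_of_continuous hφ.smooth.continuous),
      ← integralL_toLp (memLp_two_of_continuous (hφ.smooth.continuous_deriv (by simp)))]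
    refine isClosed_eq ?_ ?_
    · exact (integralL a b E _).continuous.comp (WithLp.fstL 2 ℝ (L2 a b E) (L2 a b E)).continuous
    · exact ((integralL a b E _).continuous.comp
        (WithLp.sndL 2 ℝ (L2 a b E) (L2 a b E)).continuous).neg
  exact hcl.completeSpace_coe

/-- The value at `ω` of the continuous representative of a function of `H^1((a, b), E)`,
through the formula
`f(ω) = (b - a)⁻¹ ∫_a^b (f(s) + (s - b) f'(s)) ds + ∫_a^ω f'(s) ds`,
which makes it a continuous linear functional of `f`. -/
def H1.eval [CompleteSpace E] (ω : ℝ) : H1 a b E →L[ℝ] E :=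
  (b - a)⁻¹ • ((integralL a b E ((memLp_two_of_continuous (f := fun _ => 1)
      continuous_const).toLp _)).comp H1.toL2L +
    (integralL a b E ((memLp_two_of_continuous (f := fun s => s - b)
      (continuous_sub_right b)).toLp _)).comp H1.derivL) +
  (integralL a b E ((memLp_indicator_one ω).toLp _)).comp H1.derivL

/-- `ω ↦ H1.eval ω f` is the absolutely continuous representative of `f`. -/
theorem H1.exists_isPrimitiveOn [CompleteSpace E] (hab : a < b) (f : H1 a b E) :
    IsPrimitiveOn a b (fun ω => H1.eval ω f) f.dfn ∧
      f.fn =ᵐ[intervalMeasure a b] fun ω => H1.eval ω f := by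
  obtain ⟨u, hu, hfu⟩ : ∃ u, IsPrimitiveOn a b u f.dfn ∧ f.fn =ᵐ[intervalMeasure a b] u :=
    f.hasWeakDeriv.exists_isPrimitiveOn hab (integrableOn_L2 _) (integrableOn_L2 _)
  have hprod := (isPrimitiveOn_of_contDiff (F := fun s => s - b) (by fun_prop) a b).bilin
    (ContinuousLinearMap.lsmul ℝ ℝ) hu
  have h1 := hprod.eq b ⟨hab.le, le_rfl⟩
  have hder : deriv (fun s : ℝ => s - b) = fun _ => 1 := by ext s; simp
  simp only [ContinuousLinearMap.lsmul_apply, sub_self, zero_smul, hder, one_smul] at h1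
  have iu : IntegrableOn f.fn (Ioo a b) := integrableOn_L2 _
  have id : IntegrableOn (fun s => (s - b) • f.dfn s) (Ioo a b) :=
    ((Lp.memLp (H1.derivL f)).smul (r := 1) (memLp_two_of_continuous
      (continuous_sub_right b))).integrable le_rfl
  have h2 : ∫ s in Ioc a b, (u s + (s - b) • f.dfn s) =
      (∫ s in Ioo a b, f.fn s) + ∫ s in Ioo a b, (s - b) • f.dfn s := by
    rw [integral_Ioc_eq_integral_Ioo, ← integral_add iu id]
    refine integral_congr_ae ?_
    filter_upwards [hfu] with s hs
    rw [hs]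
  have hua : u a = (b - a)⁻¹ • ((∫ s in Ioo a b, f.fn s) + ∫ s in Ioo a b, (s - b) • f.dfn s) := by
    rw [← h2, eq_inv_smul_iff₀ (sub_pos.2 hab).ne', eq_neg_of_add_eq_zero_right h1.symm,
      ← neg_smul, neg_sub]
  have key : ∀ ω ∈ Icc a b, H1.eval ω f = u ω := by
    intro ω hω
    rw [hu.eq ω hω, hua]
    simp only [H1.eval, add_apply, smul_apply, ContinuousLinearMap.comp_apply,
      integralL_toLp, one_smul, H1.coeFn_toL2L, H1.coeFn_derivL]
    congr 1
    have : ∀ s, (Iic ω).indicator (fun _ => (1 : ℝ)) s • f.dfn s = (Iic ω).indicator f.dfn s := by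
      intro s; by_cases h : s ∈ Iic ω <;> simp [h]
    simp only [this]
    rw [← integral_Ioc_eq_integral_Ioo, integral_indicator measurableSet_Iic,
      Measure.restrict_restrict measurableSet_Iic]
    congr 2
    ext s
    simp only [mem_inter_iff, mem_Iic, mem_Ioc]
    exact ⟨fun h => ⟨h.2.1, h.1⟩, fun h => ⟨h.2, h.1, h.2.trans hω.2⟩⟩
  refine ⟨⟨hu.integrable, fun x hx => ?_⟩, ?_⟩
  · simp only [key x hx, key a ⟨le_rfl, hab.le⟩, hu.eq x hx]
  · filter_upwards [hfu, ae_restrict_mem measurableSet_Ioo] with x hx hxm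
    rw [hx, key x (Ioo_subset_Icc_self hxm)]

theorem H1.exists_norm_eval_le (a b : ℝ) (E : Type*) [NormedAddCommGroup E] [NormedSpace ℝ E]
    [CompleteSpace E] : ∃ C, 0 ≤ C ∧ ∀ ω (f : H1 a b E), ‖H1.eval ω f‖ ≤ C * ‖f‖ := by
  set K : H1 a b E →L[ℝ] E :=
    (b - a)⁻¹ • ((integralL a b E ((memLp_two_of_continuous (f := fun _ => 1)
      continuous_const).toLp _)).comp H1.toL2L +
    (integralL a b E ((memLp_two_of_continuous (f := fun s => s - b)
      (continuous_sub_right b)).toLp _)).comp H1.derivL) with hK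
  set M : ℝ := (measureUnivNNReal (intervalMeasure a b) : ℝ) ^ ((2 : ENNReal).toReal)⁻¹ * 1
  set P := (ContinuousLinearMap.lsmul ℝ ℝ : ℝ →L[ℝ] E →L[ℝ] E).lpPairing (intervalMeasure a b) 2 2
  have hM : ∀ ω, ‖(memLp_indicator_one (a := a) (b := b) ω).toLp _‖ ≤ M := fun ω =>
    Lp.norm_le_of_ae_bound zero_le_one (by
      filter_upwards [(memLp_indicator_one (a := a) (b := b) ω).coeFn_toLp] with x hx
      rw [hx]
      by_cases h : x ∈ Iic ω <;> simp [h])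
  have hM0 : 0 ≤ M := (norm_nonneg _).trans (hM 0)
  refine ⟨‖K‖ + ‖P‖ * M * ‖(H1.derivL : H1 a b E →L[ℝ] _)‖, by positivity, fun ω f => ?_⟩
  have : H1.eval ω f = K f + P ((memLp_indicator_one ω).toLp _) (H1.derivL f) := rfl
  rw [this, add_mul]
  refine (norm_add_le _ _).trans (add_le_add (K.le_opNorm f) ?_)
  calc _ ≤ ‖P‖ * ‖(memLp_indicator_one (a := a) (b := b) ω).toLp _‖ * ‖H1.derivL f‖ :=
        P.le_opNorm₂ _ _
    _ ≤ ‖P‖ * M * (‖(H1.derivL : H1 a b E →L[ℝ] _)‖ * ‖f‖) := by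
        gcongr
        · exact hM ω
        · exact ContinuousLinearMap.le_opNorm _ _
    _ = _ := by ring

/-- The Sobolev embedding of `H^1` into `L^∞`. -/
theorem H1.exists_ae_norm_le (a b : ℝ) (E : Type*) [NormedAddCommGroup E] [NormedSpace ℝ E]
    [CompleteSpace E] :
    ∃ C, ∀ f : H1 a b E, ∀ᵐ x ∂(intervalMeasure a b), ‖f.fn x‖ ≤ C * ‖f‖ := by
  rcases lt_or_ge a b with hab | hab
  · obtain ⟨C, -, hC⟩ := H1.exists_norm_eval_le a b E
    refine ⟨C, fun f => ?_⟩
    filter_upwards [(f.exists_isPrimitiveOn hab).2] with x hx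
    rw [hx]
    exact hC x f
  · refine ⟨0, fun f => ?_⟩
    simp [intervalMeasure, Ioo_eq_empty hab.not_gt]

theorem H1.memLp_top [CompleteSpace E] (f : H1 a b E) : MemLp f.fn ⊤ (intervalMeasure a b) := by
  obtain ⟨C, hC⟩ := H1.exists_ae_norm_le a b E
  exact memLp_top_of_bound (Lp.aestronglyMeasurable _) _ (hC f)

/-- The inclusion of `H^1` into `L^∞`. -/
def H1.toLinf [CompleteSpace E] : H1 a b E →L[ℝ] Lp E ⊤ (intervalMeasure a b) :=
  LinearMap.mkContinuousOfExistsBound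
    { toFun := fun f => f.memLp_top.toLp _
      map_add' := fun f g => by
        rw [← MemLp.toLp_add]
        exact (MemLp.toLp_eq_toLp_iff _ _).2 (Lp.coeFn_add f.toL2 g.toL2)
      map_smul' := fun c f => by
        rw [RingHom.id_apply, ← MemLp.toLp_const_smul]
        exact (MemLp.toLp_eq_toLp_iff _ _).2 (Lp.coeFn_smul c f.toL2) }
    (by
      obtain ⟨C, hC⟩ := H1.exists_ae_norm_le a b E
      refine ⟨|C|, fun f => ?_⟩
      have := Lp.norm_le_of_ae_bound (f := f.memLp_top.toLp _) (C := |C| * ‖f‖) (by positivity) (by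
        filter_upwards [hC f, f.memLp_top.coeFn_toLp] with x hx hx'
        rw [hx']
        exact hx.trans (by gcongr; exact le_abs_self C))
      simpa using this)

theorem H1.coeFn_toLinf [CompleteSpace E] (f : H1 a b E) :
    H1.toLinf f =ᵐ[intervalMeasure a b] f.fn :=
  f.memLp_top.coeFn_toLp

/-- The product `B(u, f)` of a function `u` of `H^1` and a function `f` of `L^2`. -/
def H1.mulL2 [CompleteSpace E] (B : E →L[ℝ] F →L[ℝ] G) :
    H1 a b E →L[ℝ] L2 a b F →L[ℝ] L2 a b G :=
  (B.holderL (intervalMeasure a b) ⊤ 2 2).comp H1.toLinf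

theorem H1.coeFn_mulL2 [CompleteSpace E] (B : E →L[ℝ] F →L[ℝ] G) (u : H1 a b E) (f : L2 a b F) :
    H1.mulL2 B u f =ᵐ[intervalMeasure a b] fun x => B (u.fn x) (f x) := by
  filter_upwards [B.coeFn_holder (r := 2) (H1.toLinf u) f, u.coeFn_toLinf] with x hx hx'
  rw [← hx']
  exact hx

/-- The product rule for weak derivatives in `H^1`. -/
theorem H1.hasWeakDeriv_mulL2 [CompleteSpace E] [CompleteSpace F] [CompleteSpace G]
    (B : E →L[ℝ] F →L[ℝ] G) (u : H1 a b E) (v : H1 a b F) :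
    HasWeakDeriv a b (H1.mulL2 B u (H1.toL2L v))
      (H1.mulL2 B.flip v (H1.derivL u) + H1.mulL2 B u (H1.derivL v) : L2 a b G) := by
  rcases lt_or_ge a b with hab | hab
  · obtain ⟨hu, hu'⟩ := u.exists_isPrimitiveOn hab
    obtain ⟨hv, hv'⟩ := v.exists_isPrimitiveOn hab
    refine ((hu.bilin B hv).hasWeakDeriv hab).congr ?_ ?_
    · filter_upwards [hu', hv', H1.coeFn_mulL2 B u (H1.toL2L v)] with x h1 h2 h3
      rw [h3, H1.coeFn_toL2L, h1, h2]
    · filter_upwards [hu', hv', H1.coeFn_mulL2 B u (H1.derivL v),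
        H1.coeFn_mulL2 B.flip v (H1.derivL u), Lp.coeFn_add (H1.mulL2 B.flip v (H1.derivL u))
        (H1.mulL2 B u (H1.derivL v))] with x h1 h2 h3 h4 h5
      rw [h5, Pi.add_apply, h3, h4, H1.coeFn_derivL, H1.coeFn_derivL, h1, h2,
        ContinuousLinearMap.flip_apply]
  · intro φ _
    simp [Ioo_eq_empty hab.not_gt]

theorem H1.norm_le_add (f : H1 a b E) : ‖f‖ ≤ ‖H1.toL2L f‖ + ‖H1.derivL f‖ := by
  refine le_of_sq_le_sq ?_ (by positivity)
  rw [H1.norm_sq_eq]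
  nlinarith [norm_nonneg (H1.toL2L f), norm_nonneg (H1.derivL f)]

/-- The product `B(u, v)` of two functions of `H^1`. -/
def H1.bilin [CompleteSpace E] [CompleteSpace F] [CompleteSpace G] (B : E →L[ℝ] F →L[ℝ] G) :
    H1 a b E →L[ℝ] H1 a b F →L[ℝ] H1 a b G :=
  LinearMap.mkContinuous₂
    (LinearMap.mk₂ ℝ
      (fun u v => ⟨WithLp.toLp 2 (H1.mulL2 B u (H1.toL2L v),
        H1.mulL2 B.flip v (H1.derivL u) + H1.mulL2 B u (H1.derivL v)),
        H1.hasWeakDeriv_mulL2 B u v⟩)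
      (fun u u' v => Subtype.ext (WithLp.ofLp_injective 2 (Prod.ext (by simp) (by simp; abel))))
      (fun c u v => Subtype.ext (WithLp.ofLp_injective 2 (Prod.ext (by simp) (by simp))))
      (fun u v v' => Subtype.ext (WithLp.ofLp_injective 2 (Prod.ext (by simp) (by simp; abel))))
      (fun c u v => Subtype.ext (WithLp.ofLp_injective 2 (Prod.ext (by simp) (by simp)))))
    (‖(H1.mulL2 B : H1 a b E →L[ℝ] _)‖ * ‖(H1.toL2L : H1 a b F →L[ℝ] _)‖ +
      (‖(H1.mulL2 B.flip : H1 a b F →L[ℝ] _)‖ * ‖(H1.derivL : H1 a b E →L[ℝ] _)‖ +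
        ‖(H1.mulL2 B : H1 a b E →L[ℝ] _)‖ * ‖(H1.derivL : H1 a b F →L[ℝ] _)‖))
    (fun u v => by
      refine (H1.norm_le_add _).trans ?_
      have h1 : ‖H1.mulL2 B u (H1.toL2L v)‖ ≤ ‖(H1.mulL2 B : H1 a b E →L[ℝ] _)‖ * ‖u‖ *
          (‖(H1.toL2L : H1 a b F →L[ℝ] _)‖ * ‖v‖) :=
        (ContinuousLinearMap.le_opNorm₂ _ _ _).trans
          (by gcongr; exact ContinuousLinearMap.le_opNorm _ _)
      have h2 : ‖H1.mulL2 B u (H1.derivL v)‖ ≤ ‖(H1.mulL2 B : H1 a b E →L[ℝ] _)‖ * ‖u‖ *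
          (‖(H1.derivL : H1 a b F →L[ℝ] _)‖ * ‖v‖) :=
        (ContinuousLinearMap.le_opNorm₂ _ _ _).trans
          (by gcongr; exact ContinuousLinearMap.le_opNorm _ _)
      have h3 : ‖H1.mulL2 B.flip v (H1.derivL u)‖ ≤
          ‖(H1.mulL2 B.flip : H1 a b F →L[ℝ] _)‖ * ‖v‖ *
          (‖(H1.derivL : H1 a b E →L[ℝ] _)‖ * ‖u‖) :=
        (ContinuousLinearMap.le_opNorm₂ _ _ _).trans
          (by gcongr; exact ContinuousLinearMap.le_opNorm _ _)
      refine (add_le_add h1 ((norm_add_le _ _).trans (add_le_add h3 h2))).trans (le_of_eq ?_)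
      ring)

theorem H1.derivL_bilin [CompleteSpace E] [CompleteSpace F] [CompleteSpace G]
    (B : E →L[ℝ] F →L[ℝ] G) (u : H1 a b E) (v : H1 a b F) :
    H1.derivL (H1.bilin B u v) = H1.mulL2 B.flip v (H1.derivL u) + H1.mulL2 B u (H1.derivL v) :=
  rfl

theorem H1.fn_bilin [CompleteSpace E] [CompleteSpace F] [CompleteSpace G]
    (B : E →L[ℝ] F →L[ℝ] G) (u : H1 a b E) (v : H1 a b F) :
    (H1.bilin B u v).fn =ᵐ[intervalMeasure a b] fun x => B (u.fn x) (v.fn x) :=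
  H1.coeFn_mulL2 B u (H1.toL2L v)

end Sobolev

/-! ### Weak convergence and Grönwall's inequality -/

section Weak

variable {X Y : Type*} [NormedAddCommGroup X] [NormedSpace ℝ X] [NormedAddCommGroup Y]
  [NormedSpace ℝ Y]

theorem WeaklyTendsto.map {x : ℕ → X} {y : X} (h : WeaklyTendsto x y) (L : X →L[ℝ] Y) :
    WeaklyTendsto (fun n => L (x n)) (L y) :=
  fun l => h (l.comp L)

theorem WeaklyTendsto.congr' {x x' : ℕ → X} {y : X} (h : WeaklyTendsto x y)
    (he : x =ᶠ[atTop] x') : WeaklyTendsto x' y :=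
  fun l => (h l).congr' (he.mono fun n hn => by simp only [hn])

theorem WeaklyTendsto.add_strong {x z : ℕ → X} {y : X} (h : WeaklyTendsto x y)
    (hz : Tendsto z atTop (𝓝 0)) : WeaklyTendsto (fun n => x n + z n) y := by
  intro l
  simpa using (h l).add ((l.continuous.tendsto 0).comp hz)

theorem WeaklyTendsto.sub_const {x : ℕ → X} {y : X} (h : WeaklyTendsto x y) (z : X) :
    WeaklyTendsto (fun n => x n - z) (y - z) := by
  intro l
  simpa using (h l).sub_const (l z)

theorem WeaklyTendsto.add_const {x : ℕ → X} {y : X} (h : WeaklyTendsto x y) (z : X) :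
    WeaklyTendsto (fun n => x n + z) (y + z) := by
  intro l
  simpa using (h l).add_const (l z)

/-- A weakly convergent sequence is bounded (Banach–Steinhaus in the bidual). -/
theorem WeaklyTendsto.exists_norm_le {x : ℕ → X} {y : X} (h : WeaklyTendsto x y) :
    ∃ C, ∀ n, ‖x n‖ ≤ C := by
  obtain ⟨C, hC⟩ := banach_steinhaus
    (g := fun n => NormedSpace.inclusionInDoubleDual ℝ X (x n)) fun l => by
      obtain ⟨C, hC⟩ := (h l).norm.bddAbove_range
      exact ⟨C, fun n => hC ⟨n, rfl⟩⟩
  refine ⟨C, fun n => ?_⟩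
  have := (NormedSpace.inclusionInDoubleDualLi ℝ (E := X)).norm_map (x n)
  rw [← this]
  exact hC n

/-- Grönwall's inequality with a source term that depends on time. -/
theorem norm_le_exp_mul_integral {f f' : ℝ → X} {ε : ℝ → ℝ} {K a b : ℝ} (hK : 0 ≤ K)
    (hf : ContinuousOn f (Icc a b)) (hf' : ∀ s ∈ Ico a b, HasDerivWithinAt f (f' s) (Ici s) s)
    (hε : Continuous ε) (hε0 : ∀ s, 0 ≤ ε s)
    (bound : ∀ s ∈ Ico a b, ‖f' s‖ ≤ K * ‖f s‖ + ε s) :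
    ∀ s ∈ Icc a b, ‖f s‖ ≤ Real.exp (K * (s - a)) * (‖f a‖ + ∫ r in a..s, ε r) := by
  intro s hs
  have key : ∀ η > 0, ‖f s‖ ≤ Real.exp (K * (s - a)) * (‖f a‖ + (∫ r in a..s, ε r) +
      η * (s - a)) := by
    intro η hη
    have hB : ∀ x, HasDerivAt (fun x => Real.exp (K * (x - a)) * (‖f a‖ + (∫ r in a..x, ε r) +
        η * (x - a)))
        (Real.exp (K * (x - a)) * K * (‖f a‖ + (∫ r in a..x, ε r) + η * (x - a)) +
          Real.exp (K * (x - a)) * (ε x + η)) x := by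
      intro x
      have h1 : HasDerivAt (fun x => Real.exp (K * (x - a))) (Real.exp (K * (x - a)) * K) x := by
        have : HasDerivAt (fun x => K * (x - a)) K x := by
          simpa using ((hasDerivAt_id x).sub_const a).const_mul K
        exact this.exp
      have h2 : HasDerivAt (fun x => ∫ r in a..x, ε r) (ε x) x :=
        intervalIntegral.integral_hasDerivAt_right (hε.intervalIntegrable _ _)
          (hε.stronglyMeasurableAtFilter _ _) hε.continuousAt
      have h3 : HasDerivAt (fun x => η * (x - a)) η x := by
        simpa using ((hasDerivAt_id x).sub_const a).const_mul η
      exact h1.mul ((h2.const_add _).add h3)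
    refine image_norm_le_of_norm_deriv_right_lt_deriv_boundary hf hf' (by simp) hB ?_ hs
    intro x hx hfx
    have h1 : 1 ≤ Real.exp (K * (x - a)) :=
      Real.one_le_exp (mul_nonneg hK (sub_nonneg.2 hx.1))
    calc ‖f' x‖ ≤ K * ‖f x‖ + ε x := bound x hx
      _ < K * ‖f x‖ + (ε x + η) := by linarith
      _ ≤ K * ‖f x‖ + Real.exp (K * (x - a)) * (ε x + η) := by
          gcongr
          exact le_mul_of_one_le_left (by linarith [hε0 x]) h1
      _ = _ := by rw [hfx]; ring
  have hlim : Tendsto (fun η : ℝ => Real.exp (K * (s - a)) * (‖f a‖ + (∫ r in a..s, ε r) +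
      η * (s - a))) (𝓝[>] 0) (𝓝 (Real.exp (K * (s - a)) * (‖f a‖ + ∫ r in a..s, ε r))) := by
    have : Continuous fun η : ℝ => Real.exp (K * (s - a)) * (‖f a‖ + (∫ r in a..s, ε r) +
      η * (s - a)) := by fun_prop
    simpa using (this.tendsto 0).mono_left nhdsWithin_le_nhds
  exact ge_of_tendsto hlim (eventually_mem_nhdsWithin.mono fun η hη => key η hη)

/-- The propagator of a linear equation on a short time interval. -/
theorem exists_propagator [CompleteSpace X] {A : ℝ → X →L[ℝ] X} {a b K : ℝ} (hab : a ≤ b)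
    (hA : ContinuousOn A (Icc a b)) (hK : ∀ s ∈ Icc a b, ‖A s‖ ≤ K) (hKab : K * (b - a) ≤ 1 / 2) :
    ∃ V : ℝ → X →L[ℝ] X, V a = ContinuousLinearMap.id ℝ X ∧
      ∀ s ∈ Icc a b, HasDerivWithinAt V ((A s).comp (V s)) (Icc a b) s := by
  have hK0 : 0 ≤ K := (norm_nonneg _).trans (hK a ⟨le_rfl, hab⟩)
  lift K to NNReal using hK0
  -- on the ball of radius `1` about the identity the vector field is bounded by `2 K`
  have hPL : IsPicardLindelof (fun s (V : X →L[ℝ] X) => (A s).comp V)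
      (⟨a, le_rfl, hab⟩ : Icc a b) (ContinuousLinearMap.id ℝ X) 1 0 (2 * K) K := by
    refine ⟨fun s hs => ?_, fun V _ => ?_, fun s hs V hV => ?_, ?_⟩
    · refine LipschitzWith.lipschitzOnWith (LipschitzWith.of_dist_le_mul fun V W => ?_)
      rw [dist_eq_norm, dist_eq_norm, ← ContinuousLinearMap.comp_sub]
      exact (ContinuousLinearMap.opNorm_comp_le _ _).trans (by gcongr; exact hK s hs)
    · exact hA.clm_comp continuousOn_const
    · have h1 : ‖V‖ ≤ 2 := by
        have h2 : ‖V - ContinuousLinearMap.id ℝ X‖ ≤ 1 := by simpa [dist_eq_norm] using hV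
        have h3 := ContinuousLinearMap.norm_id_le (𝕜 := ℝ) (E := X)
        have h4 := norm_add_le (V - ContinuousLinearMap.id ℝ X) (ContinuousLinearMap.id ℝ X)
        rw [sub_add_cancel] at h4
        linarith
      refine (ContinuousLinearMap.opNorm_comp_le _ _).trans ?_
      push_cast
      nlinarith [hK s hs, norm_nonneg (A s), norm_nonneg V]
    · simp only [sub_self, NNReal.coe_mul, NNReal.coe_one, NNReal.coe_zero, sub_zero]
      rw [max_eq_left (sub_nonneg.2 hab)]
      push_cast
      linarith
  exact hPL.exists_eq_forall_mem_Icc_hasDerivWithinAt₀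

end Weak

/-! ### Weak sequential continuity of bilinear feedback systems -/

section Feedback

variable {ι X : Type*} [NormedAddCommGroup X] [NormedSpace ℝ X]

/-- The data of the equation `N' = ∑ i, u i(t, N) • A i(t) N` with the quadratic feedback laws
`u i(t, N) = p i(t)(N, N) + l i(t)(N)`. The operators depend continuously on time, and the
quadratic forms are compact in their first argument. -/
structure FeedbackSystem (ι X : Type*) [NormedAddCommGroup X] [NormedSpace ℝ X] where
  /-- The operators driven by the controls. -/
  A : ι → ℝ → X →L[ℝ] X
  /-- The quadratic parts of the feedback laws. -/
  p : ι → ℝ → X →L[ℝ] X →L[ℝ] ℝ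
  /-- The linear parts of the feedback laws. -/
  l : ι → ℝ → X →L[ℝ] ℝ
  continuous_A : ∀ i, Continuous (A i)
  continuous_p : ∀ i, Continuous (p i)
  continuous_l : ∀ i, Continuous (l i)
  compact : ∀ i s (x : ℕ → X), WeaklyTendsto x 0 → Tendsto (fun n => p i s (x n)) atTop (𝓝 0)

namespace FeedbackSystem

variable (Φ : FeedbackSystem ι X)

/-- The feedback law. -/
def control (i : ι) (s : ℝ) (x : X) : ℝ := Φ.p i s x x + Φ.l i s x

/-- A seminorm of `z` which tends to `0` along weakly null sequences, and which controls the
variation of the feedback laws at `y` in the direction `z`. -/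
def defect (i : ι) (s M : ℝ) (y z : X) : ℝ :=
  M * ‖Φ.p i s z‖ + ‖Φ.p i s y z‖ + ‖Φ.l i s z‖

theorem defect_nonneg {i : ι} {s M : ℝ} (hM : 0 ≤ M) (y z : X) : 0 ≤ Φ.defect i s M y z := by
  unfold defect; positivity

theorem abs_control_sub_le {i : ι} {s M C : ℝ} {x y z : X} (hx : ‖x‖ ≤ M) (hy : ‖y‖ ≤ M)
    (hp : ‖Φ.p i s‖ ≤ C) (hl : ‖Φ.l i s‖ ≤ C) :
    |Φ.control i s x - Φ.control i s y| ≤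
      Φ.defect i s M y z + (2 * M + 1) * C * ‖x - y - z‖ := by
  have hM : 0 ≤ M := (norm_nonneg _).trans hx
  have hC : 0 ≤ C := (norm_nonneg (Φ.p i s)).trans hp
  set w := x - y - z with hw
  have hxy : x - y = z + w := by rw [hw]; abel
  have e1 : Φ.control i s x - Φ.control i s y =
      (Φ.p i s z x + Φ.p i s y z + Φ.l i s z) + (Φ.p i s w x + Φ.p i s y w + Φ.l i s w) := by
    have h1 : Φ.p i s x x - Φ.p i s y y = Φ.p i s (x - y) x + Φ.p i s y (x - y) := by simp
    have h2 : Φ.l i s x - Φ.l i s y = Φ.l i s (x - y) := by simp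
    unfold control
    rw [add_sub_add_comm, h1, h2, hxy]
    simp only [map_add, add_apply]
    ring
  have b1 : ‖Φ.p i s z x‖ ≤ M * ‖Φ.p i s z‖ := by
    rw [mul_comm]; exact (Φ.p i s z).le_of_opNorm_le_of_le le_rfl hx
  have b2 : ‖Φ.p i s w x‖ ≤ C * ‖w‖ * M :=
    ((Φ.p i s).le_opNorm₂ w x).trans (by gcongr)
  have b3 : ‖Φ.p i s y w‖ ≤ C * M * ‖w‖ :=
    ((Φ.p i s).le_opNorm₂ y w).trans (by gcongr)
  have b4 : ‖Φ.l i s w‖ ≤ C * ‖w‖ := (Φ.l i s).le_of_opNorm_le hl w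
  rw [e1, ← Real.norm_eq_abs]
  refine (norm_add_le _ _).trans (add_le_add ?_ ?_)
  · exact (norm_add₃_le).trans (by unfold defect; gcongr)
  · exact (norm_add₃_le).trans (by linarith)

theorem tendsto_defect {i : ι} {s : ℝ} (M : ℝ) (y : X) {z : ℕ → X} (hz : WeaklyTendsto z 0) :
    Tendsto (fun n => Φ.defect i s M y (z n)) atTop (𝓝 0) := by
  have h1 := ((Φ.compact i s z hz).norm.const_mul M)
  have h2 := (hz (Φ.p i s y)).norm
  have h3 := (hz (Φ.l i s)).norm
  simpa [defect] using (h1.add h2).add h3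

theorem defect_le {i : ι} {s M C : ℝ} {y z : X} (hy : ‖y‖ ≤ M)
    (hp : ‖Φ.p i s‖ ≤ C) (hl : ‖Φ.l i s‖ ≤ C) :
    Φ.defect i s M y z ≤ (2 * M + 1) * C * ‖z‖ := by
  have hM : 0 ≤ M := (norm_nonneg _).trans hy
  have hC : 0 ≤ C := (norm_nonneg (Φ.p i s)).trans hp
  have b1 : ‖Φ.p i s z‖ ≤ C * ‖z‖ := (Φ.p i s).le_of_opNorm_le hp z
  have b3 : ‖Φ.p i s y z‖ ≤ C * M * ‖z‖ :=
    ((Φ.p i s).le_opNorm₂ y z).trans (by gcongr)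
  have b4 : ‖Φ.l i s z‖ ≤ C * ‖z‖ := (Φ.l i s).le_of_opNorm_le hl z
  unfold defect
  nlinarith [mul_le_mul_of_nonneg_left b1 hM]

/-- The feedback laws are weakly sequentially continuous. -/
theorem tendsto_control {i : ι} {s : ℝ} {x : ℕ → X} {y : X} (h : WeaklyTendsto x y) :
    Tendsto (fun n => Φ.control i s (x n)) atTop (𝓝 (Φ.control i s y)) := by
  obtain ⟨M, hM⟩ := h.exists_norm_le
  have h0 := Φ.tendsto_defect (i := i) (s := s) (max M ‖y‖) y
    (by simpa using h.sub_const y : WeaklyTendsto (fun n => x n - y) 0)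
  rw [tendsto_iff_norm_sub_tendsto_zero]
  refine squeeze_zero (fun n => norm_nonneg _) (fun n => ?_) h0
  have := Φ.abs_control_sub_le (i := i) (s := s) (z := x n - y) ((hM n).trans (le_max_left M ‖y‖))
    (le_max_right M ‖y‖) (le_max_left ‖Φ.p i s‖ ‖Φ.l i s‖) (le_max_right ‖Φ.p i s‖ ‖Φ.l i s‖)
  simpa using this

theorem abs_control_le {i : ι} {s M C : ℝ} {x : X} (hx : ‖x‖ ≤ M)
    (hp : ‖Φ.p i s‖ ≤ C) (hl : ‖Φ.l i s‖ ≤ C) : |Φ.control i s x| ≤ C * M * M + C * M := by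
  have hM : 0 ≤ M := (norm_nonneg _).trans hx
  have hC : 0 ≤ C := (norm_nonneg (Φ.p i s)).trans hp
  unfold control
  refine (abs_add_le _ _).trans (add_le_add ?_ ?_)
  · exact ((Φ.p i s).le_opNorm₂ x x).trans (by gcongr)
  · exact (Φ.l i s).le_of_opNorm_le_of_le hl hx

variable [Fintype ι]

/-- The vector field of the closed loop system. -/
def field (s : ℝ) (x : X) : X := ∑ i, Φ.control i s x • Φ.A i s x

/-- `N` solves the closed loop system on `[τ, ∞)`. -/
def IsSolution (τ : ℝ) (N : ℝ → X) : Prop :=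
  ∀ t ∈ Ici τ, HasDerivWithinAt N (Φ.field t (N t)) (Ici τ) t

variable {Φ}

theorem IsSolution.mono {τ τ' : ℝ} {N : ℝ → X} (h : Φ.IsSolution τ N) (hτ : τ ≤ τ') :
    Φ.IsSolution τ' N :=
  fun t ht => (h t (hτ.trans ht)).mono (Ici_subset_Ici.2 hτ)

theorem IsSolution.continuousOn {τ : ℝ} {N : ℝ → X} (h : Φ.IsSolution τ N) :
    ContinuousOn N (Ici τ) :=
  fun t ht => (h t ht).continuousWithinAt

theorem IsSolution.hasDerivWithinAt_Ici {τ t : ℝ} {N : ℝ → X} (h : Φ.IsSolution τ N)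
    (ht : τ ≤ t) : HasDerivWithinAt N (Φ.field t (N t)) (Ici t) t :=
  (h t ht).mono (Ici_subset_Ici.2 ht)

variable (Φ)

theorem exists_bound (a b : ℝ) : ∃ C, 0 ≤ C ∧
    ∀ s ∈ Icc a b, ∀ i, ‖Φ.A i s‖ ≤ C ∧ ‖Φ.p i s‖ ≤ C ∧ ‖Φ.l i s‖ ≤ C := by
  have hc : Continuous fun s => ∑ i, (‖Φ.A i s‖ + ‖Φ.p i s‖ + ‖Φ.l i s‖) :=
    continuous_finsetSum _ fun i _ => by
      have h1 : Continuous fun s => ‖Φ.A i s‖ := (Φ.continuous_A i).norm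
      have h2 : Continuous fun s => ‖Φ.p i s‖ :=
        Continuous.norm (E := X →L[ℝ] X →L[ℝ] ℝ) (Φ.continuous_p i)
      have h3 : Continuous fun s => ‖Φ.l i s‖ := (Φ.continuous_l i).norm
      exact (h1.add h2).add h3
  obtain ⟨C, hC⟩ := isCompact_Icc.exists_bound_of_continuousOn (hc.continuousOn (s := Icc a b))
  refine ⟨|C|, abs_nonneg _, fun s hs i => ?_⟩
  have h1 : ‖Φ.A i s‖ + ‖Φ.p i s‖ + ‖Φ.l i s‖ ≤ ∑ i, (‖Φ.A i s‖ + ‖Φ.p i s‖ + ‖Φ.l i s‖) :=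
    Finset.single_le_sum (f := fun i => ‖Φ.A i s‖ + ‖Φ.p i s‖ + ‖Φ.l i s‖)
      (fun _ _ => by positivity) (Finset.mem_univ i)
  have h2 := ((le_abs_self _).trans (hC s hs)).trans (le_abs_self C)
  have := norm_nonneg (Φ.A i s)
  have := norm_nonneg (Φ.p i s)
  have := norm_nonneg (Φ.l i s)
  exact ⟨by linarith, by linarith, by linarith⟩

theorem norm_field_le {s M C : ℝ} {x : X} (hx : ‖x‖ ≤ M)
    (h : ∀ i, ‖Φ.A i s‖ ≤ C ∧ ‖Φ.p i s‖ ≤ C ∧ ‖Φ.l i s‖ ≤ C) :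
    ‖Φ.field s x‖ ≤ Fintype.card ι * ((C * M * M + C * M) * (C * M)) := by
  have hM : 0 ≤ M := (norm_nonneg _).trans hx
  unfold field
  refine (norm_sum_le _ _).trans ?_
  rw [← nsmul_eq_mul, ← Finset.card_univ, ← Finset.sum_const]
  refine Finset.sum_le_sum fun i _ => ?_
  rw [norm_smul]
  have hb := Φ.abs_control_le hx (h i).2.1 (h i).2.2
  exact mul_le_mul hb ((Φ.A i s).le_of_opNorm_le_of_le (h i).1 hx) (norm_nonneg _)
    ((abs_nonneg _).trans hb)

/-- The operator `∑ i, u i(s, y) A i(s)`, for the controls generated by the state `y`. -/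
def drift (s : ℝ) (y : X) : X →L[ℝ] X := ∑ i, Φ.control i s y • Φ.A i s

theorem norm_drift_le {s M C : ℝ} {y : X} (hy : ‖y‖ ≤ M)
    (h : ∀ i, ‖Φ.A i s‖ ≤ C ∧ ‖Φ.p i s‖ ≤ C ∧ ‖Φ.l i s‖ ≤ C) :
    ‖Φ.drift s y‖ ≤ Fintype.card ι * ((C * M * M + C * M) * C) := by
  unfold drift
  refine (norm_sum_le _ _).trans ?_
  rw [← nsmul_eq_mul, ← Finset.card_univ, ← Finset.sum_const]
  refine Finset.sum_le_sum fun i _ => ?_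
  rw [norm_smul]
  have hb := Φ.abs_control_le hy (h i).2.1 (h i).2.2
  exact mul_le_mul hb (h i).1 (norm_nonneg _) ((abs_nonneg _).trans hb)

theorem field_sub_field (s : ℝ) (x y : X) : Φ.field s x - Φ.field s y =
    (∑ i, (Φ.control i s x - Φ.control i s y) • Φ.A i s x) + Φ.drift s y (x - y) := by
  simp only [field, drift, sum_apply, smul_apply, ← Finset.sum_sub_distrib,
    ← Finset.sum_add_distrib, map_sub]
  refine Finset.sum_congr rfl fun i _ => ?_
  module

theorem continuousOn_drift {N : ℝ → X} {S : Set ℝ} (hN : ContinuousOn N S) :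
    ContinuousOn (fun s => Φ.drift s (N s)) S := by
  unfold drift control
  refine continuousOn_finsetSum _ fun i _ => ?_
  exact ((((Φ.continuous_p i).continuousOn.clm_apply hN).clm_apply hN).add
    ((Φ.continuous_l i).continuousOn.clm_apply hN)).smul (Φ.continuous_A i).continuousOn

variable {Φ}

/-- Weak convergence propagates from the initial times `β n → s₀` to a later time `s₁`, if the
interval `[s₀, s₁]` is short. The difference to the limit solution is compared with its evolution
`V` under the linear equation that the controls of the limit solution generate. The latter is weakly
null, as `V` is a bounded operator; the remainder is small in norm by Grönwall's inequality, since
it is driven by the differences of the controls. -/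
theorem IsSolution.weaklyTendsto_step [CompleteSpace X] {N : ℕ → ℝ → X} {Ninf : ℝ → X} {β : ℕ → ℝ}
    {s₀ s₁ M C : ℝ} (h01 : s₀ < s₁) (hβ0 : ∀ n, s₀ ≤ β n) (hβ : Tendsto β atTop (𝓝 s₀))
    (hN : ∀ n, Φ.IsSolution (β n) (N n)) (hinf : Φ.IsSolution s₀ Ninf)
    (hM : ∀ n, ∀ t ≥ β n, ‖N n t‖ ≤ M) (hMinf : ∀ t ≥ s₀, ‖Ninf t‖ ≤ M)
    (hC : ∀ s ∈ Icc s₀ s₁, ∀ i, ‖Φ.A i s‖ ≤ C ∧ ‖Φ.p i s‖ ≤ C ∧ ‖Φ.l i s‖ ≤ C) (hC0 : 0 ≤ C)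
    (hshort : Fintype.card ι * ((C * M * M + C * M) * C) * (s₁ - s₀) ≤ 1 / 2)
    (hw : WeaklyTendsto (fun n => N n (β n)) (Ninf s₀)) :
    WeaklyTendsto (fun n => N n s₁) (Ninf s₁) := by
  have hM0 : 0 ≤ M := (norm_nonneg _).trans (hMinf s₀ le_rfl)
  set K : ℝ := Fintype.card ι * ((C * M * M + C * M) * C) with hK
  have hK0 : 0 ≤ K := by positivity
  have hNinfc : ContinuousOn Ninf (Icc s₀ s₁) := hinf.continuousOn.mono Icc_subset_Ici_self
  have hKb : ∀ s ∈ Icc s₀ s₁, ‖Φ.drift s (Ninf s)‖ ≤ K := fun s hs =>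
    Φ.norm_drift_le (hMinf s hs.1) (hC s hs)
  obtain ⟨V, hV0, hV⟩ := exists_propagator h01.le (Φ.continuousOn_drift hNinfc) hKb hshort
  have hVc : ContinuousOn V (Icc s₀ s₁) := fun s hs => (hV s hs).continuousWithinAt
  obtain ⟨CV, hCV⟩ := isCompact_Icc.exists_bound_of_continuousOn hVc
  have hCV0 : 0 ≤ CV := (norm_nonneg _).trans (hCV s₀ ⟨le_rfl, h01.le⟩)
  -- the initial differences
  set e : ℕ → X := fun n => N n (β n) - Ninf s₀ with he
  have hew : WeaklyTendsto e 0 := by simpa using hw.sub_const (Ninf s₀)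
  obtain ⟨Ce, hCe⟩ := hew.exists_norm_le
  have hCe0 : 0 ≤ Ce := (norm_nonneg _).trans (hCe 0)
  have hVe : ∀ s, WeaklyTendsto (fun n => V s (e n)) 0 := fun s => by
    simpa using hew.map (V s)
  -- the remainder
  set y : ℕ → ℝ → X := fun n s => N n s - Ninf s - V s (e n) with hy
  -- the source term, extended continuously outside of `[s₀, s₁]`
  set P : ℝ → ℝ := fun s => max s₀ (min s s₁) with hP
  have hPmem : ∀ s, P s ∈ Icc s₀ s₁ := fun s =>
    ⟨le_max_left _ _, max_le h01.le (min_le_right _ _)⟩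
  have hPid : ∀ s ∈ Icc s₀ s₁, P s = s := fun s hs => by
    simp only [hP, min_eq_left hs.2, max_eq_right hs.1]
  have hPc : Continuous P := by fun_prop
  set ε : ℕ → ℝ → ℝ := fun n s =>
    ∑ i, Φ.defect i (P s) M (Ninf (P s)) (V (P s) (e n)) * (C * M) with hε
  have hεc : ∀ n, Continuous (ε n) := by
    intro n
    have c1 : Continuous fun s => V (P s) := hVc.comp_continuous hPc hPmem
    have c2 : Continuous fun s => Ninf (P s) := hNinfc.comp_continuous hPc hPmem
    refine continuous_finsetSum _ fun i _ => ?_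
    have c3 : Continuous fun s => V (P s) (e n) := c1.clm_apply continuous_const
    have c4 : Continuous fun s => Φ.p i (P s) := (Φ.continuous_p i).comp hPc
    have c5 : Continuous fun s => Φ.l i (P s) := (Φ.continuous_l i).comp hPc
    exact (((continuous_const.mul (c4.clm_apply c3).norm).add
      ((c4.clm_apply c2).clm_apply c3).norm).add (c5.clm_apply c3).norm).mul continuous_const
  have hε0 : ∀ n s, 0 ≤ ε n s := fun n s => Finset.sum_nonneg fun i _ =>
    mul_nonneg (Φ.defect_nonneg hM0 _ _) (by positivity)
  have hεle : ∀ n s, ‖ε n s‖ ≤ ∑ _i : ι, ((2 * M + 1) * C * (CV * Ce)) * (C * M) := by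
    intro n s
    rw [Real.norm_of_nonneg (hε0 n s)]
    refine Finset.sum_le_sum fun i _ => ?_
    have h1 := Φ.defect_le (i := i) (z := V (P s) (e n)) (hMinf (P s) (hPmem s).1)
      (hC _ (hPmem s) i).2.1 (hC _ (hPmem s) i).2.2
    have h2 : ‖V (P s) (e n)‖ ≤ CV * Ce :=
      (V (P s)).le_of_opNorm_le_of_le (hCV _ (hPmem s)) (hCe n)
    gcongr
    exact h1.trans (by gcongr)
  have hεint : Tendsto (fun n => ∫ s in s₀..s₁, ε n s) atTop (𝓝 0) := by
    have h := intervalIntegral.tendsto_integral_filter_of_dominated_convergence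
      (a := s₀) (b := s₁) (μ := volume) (F := ε) (f := fun _ => (0 : ℝ)) (l := atTop)
      (fun _ => ∑ _i : ι, ((2 * M + 1) * C * (CV * Ce)) * (C * M))
      (Eventually.of_forall fun n => (hεc n).aestronglyMeasurable)
      (Eventually.of_forall fun n => Eventually.of_forall fun s _ => hεle n s)
      intervalIntegrable_const
      (Eventually.of_forall fun s _ => by
        have := tendsto_finsetSum Finset.univ fun i (_ : i ∈ Finset.univ) =>
          (Φ.tendsto_defect (i := i) (s := P s) M (Ninf (P s)) (hVe (P s))).mul_const (C * M)
        simpa using this)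
    simpa using h
  have hy0 : Tendsto (fun n => ‖y n (β n)‖) atTop (𝓝 0) := by
    have hmem : ∀ᶠ n in atTop, β n ∈ Icc s₀ s₁ := by
      filter_upwards [hβ.eventually_lt_const h01] with n hn using ⟨hβ0 n, hn.le⟩
    have hβw : Tendsto β atTop (𝓝[Icc s₀ s₁] s₀) :=
      tendsto_nhdsWithin_iff.2 ⟨hβ, hmem⟩
    have h1 : Tendsto (fun n => ‖Ninf s₀ - Ninf (β n)‖) atTop (𝓝 0) := by
      have := ((hNinfc s₀ ⟨le_rfl, h01.le⟩).tendsto.comp hβw).const_sub (Ninf s₀)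
      simpa using this.norm
    have h2 : Tendsto (fun n => ‖V s₀ - V (β n)‖ * Ce) atTop (𝓝 0) := by
      have := ((hVc s₀ ⟨le_rfl, h01.le⟩).tendsto.comp hβw).const_sub (V s₀)
      simpa using this.norm.mul_const Ce
    refine squeeze_zero (fun n => norm_nonneg _) (fun n => ?_) (by simpa using h1.add h2)
    have : y n (β n) = (Ninf s₀ - Ninf (β n)) + (V s₀ - V (β n)) (e n) := by
      simp only [hy, he, hV0, sub_apply, ContinuousLinearMap.id_apply]
      abel
    rw [this]
    exact (norm_add_le _ _).trans
      (add_le_add le_rfl (ContinuousLinearMap.le_opNorm_of_le _ (hCe n)))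
  set K' : ℝ := Fintype.card ι * ((2 * M + 1) * C * (C * M)) + K with hK'
  have hmain : ∀ n, β n ≤ s₁ → ‖y n s₁‖ ≤
      Real.exp (K' * (s₁ - s₀)) * (‖y n (β n)‖ + ∫ s in s₀..s₁, ε n s) := by
    intro n hn
    have hIcc : Icc (β n) s₁ ⊆ Icc s₀ s₁ := Icc_subset_Icc_left (hβ0 n)
    have hder : ∀ s ∈ Ico (β n) s₁, HasDerivWithinAt (y n)
        (Φ.field s (N n s) - Φ.field s (Ninf s) - Φ.drift s (Ninf s) (V s (e n))) (Ici s) s := by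
      intro s hs
      have hs' : s ∈ Ico s₀ s₁ := ⟨(hβ0 n).trans hs.1, hs.2⟩
      have hVs : HasDerivWithinAt V ((Φ.drift s (Ninf s)).comp (V s)) (Ici s) s :=
        ((hV s (Ico_subset_Icc_self hs')).mono (Icc_subset_Icc_left hs'.1)).mono_of_mem_nhdsWithin
          (Icc_mem_nhdsGE hs.2)
      have := ((hN n).hasDerivWithinAt_Ici hs.1).sub (hinf.hasDerivWithinAt_Ici hs'.1)
      refine (this.sub (hVs.clm_apply (hasDerivWithinAt_const s _ (e n)))).congr_deriv ?_
      simp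
    have hcont : ContinuousOn (y n) (Icc (β n) s₁) :=
      (((hN n).continuousOn.mono Icc_subset_Ici_self).sub (hNinfc.mono hIcc)).sub
        ((hVc.mono hIcc).clm_apply continuousOn_const)
    have hbound : ∀ s ∈ Ico (β n) s₁,
        ‖Φ.field s (N n s) - Φ.field s (Ninf s) - Φ.drift s (Ninf s) (V s (e n))‖ ≤
          K' * ‖y n s‖ + ε n s := by
      intro s hs
      have hsI : s ∈ Icc s₀ s₁ := ⟨(hβ0 n).trans hs.1, hs.2.le⟩
      have hNs := hM n s hs.1
      rw [Φ.field_sub_field, add_sub_assoc, ← map_sub]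
      have h1 : ‖∑ i, (Φ.control i s (N n s) - Φ.control i s (Ninf s)) • Φ.A i s (N n s)‖ ≤
          ∑ i, (Φ.defect i s M (Ninf s) (V s (e n)) + (2 * M + 1) * C * ‖y n s‖) * (C * M) := by
        refine (norm_sum_le _ _).trans (Finset.sum_le_sum fun i _ => ?_)
        rw [norm_smul]
        have hd := Φ.abs_control_sub_le (i := i) (z := V s (e n)) hNs (hMinf s hsI.1)
          (hC s hsI i).2.1 (hC s hsI i).2.2
        exact mul_le_mul hd ((Φ.A i s).le_of_opNorm_le_of_le (hC s hsI i).1 hNs) (norm_nonneg _)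
          ((abs_nonneg _).trans hd)
      have h2 : ‖Φ.drift s (Ninf s) (N n s - Ninf s - V s (e n))‖ ≤ K * ‖y n s‖ :=
        (Φ.drift s (Ninf s)).le_of_opNorm_le (hKb s hsI) _
      refine (norm_add_le _ _).trans ((add_le_add h1 h2).trans (le_of_eq ?_))
      simp only [hε, hPid s hsI, hK', add_mul, Finset.sum_add_distrib, Finset.sum_const,
        Finset.card_univ, nsmul_eq_mul]
      ring
    have hK'0 : 0 ≤ K' := by positivity
    have hg := norm_le_exp_mul_integral hK'0 hcont hder (hεc n) (hε0 n) hbound s₁ ⟨hn, le_rfl⟩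
    refine hg.trans ?_
    have hint : ∫ s in (β n)..s₁, ε n s ≤ ∫ s in s₀..s₁, ε n s :=
      intervalIntegral.integral_mono_interval (hβ0 n) hn le_rfl
        (Eventually.of_forall (hε0 n)) ((hεc n).intervalIntegrable _ _)
    have hint0 : 0 ≤ ∫ s in (β n)..s₁, ε n s :=
      intervalIntegral.integral_nonneg hn fun s _ => hε0 n s
    gcongr
    exact hβ0 n
  have hy1 : Tendsto (fun n => y n s₁) atTop (𝓝 0) := by
    rw [tendsto_zero_iff_norm_tendsto_zero]
    have hlim := (hy0.add hεint).const_mul (Real.exp (K' * (s₁ - s₀)))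
    rw [add_zero, mul_zero] at hlim
    refine squeeze_zero' (Eventually.of_forall fun n => norm_nonneg _) ?_ hlim
    filter_upwards [hβ.eventually_lt_const h01] with n hn using hmain n hn.le
  have := ((hVe s₁).add_strong hy1).add_const (Ninf s₁)
  rw [zero_add] at this
  refine this.congr' (Eventually.of_forall fun n => ?_)
  simp only [hy]
  abel

/-- Solutions of a feedback system that stay bounded depend weakly sequentially continuously on
their initial state and initial time. -/
theorem IsSolution.weaklyTendsto [CompleteSpace X] {N : ℕ → ℝ → X} {Ninf : ℝ → X} {τ : ℕ → ℝ}
    {α M : ℝ} (hτ : Tendsto τ atTop (𝓝 α)) (hN : ∀ n, Φ.IsSolution (τ n) (N n))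
    (hinf : Φ.IsSolution α Ninf) (hM : ∀ n, ∀ t ≥ τ n, ‖N n t‖ ≤ M)
    (hMinf : ∀ t ≥ α, ‖Ninf t‖ ≤ M) (hw : WeaklyTendsto (fun n => N n (τ n)) (Ninf α))
    {t : ℝ} (ht : α < t) : WeaklyTendsto (fun n => N n t) (Ninf t) := by
  have hM0 : 0 ≤ M := (norm_nonneg _).trans (hMinf α le_rfl)
  obtain ⟨C, hC0, hC⟩ := Φ.exists_bound (α - 1) t
  set K : ℝ := Fintype.card ι * ((C * M * M + C * M) * C) with hK
  have hK0 : 0 ≤ K := by positivity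
  obtain ⟨m, hm⟩ := exists_nat_gt (2 * K * (t - α))
  have hmpos : (0 : ℝ) < m := lt_of_le_of_lt (by have := sub_pos.2 ht; positivity) hm
  set h : ℝ := (t - α) / m with hh
  have hhpos : 0 < h := div_pos (sub_pos.2 ht) hmpos
  have hKh : K * h ≤ 1 / 2 := by
    rw [hh, ← mul_div_assoc, div_le_iff₀ hmpos]
    linarith
  have hmh : α + m * h = t := by
    rw [hh]; field_simp; ring
  -- the initial times may lie on either side of `α`
  have hbase : WeaklyTendsto (fun n => N n (max (τ n) α)) (Ninf α) := by
    set D : ℝ := Fintype.card ι * ((C * M * M + C * M) * (C * M))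
    have hz : Tendsto (fun n => N n (max (τ n) α) - N n (τ n)) atTop (𝓝 0) := by
      rw [tendsto_zero_iff_norm_tendsto_zero]
      have hlim : Tendsto (fun n => D * (max (τ n) α - τ n)) atTop (𝓝 0) := by
        simpa using ((hτ.max (tendsto_const_nhds (x := α))).sub hτ).const_mul D
      refine squeeze_zero' (Eventually.of_forall fun n => norm_nonneg _) ?_ hlim
      filter_upwards [hτ.eventually_const_lt (sub_one_lt α), hτ.eventually_lt_const ht] with n h1 h2
      refine norm_image_sub_le_of_norm_deriv_right_le_segment
        ((hN n).continuousOn.mono Icc_subset_Ici_self)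
        (fun s hs => (hN n).hasDerivWithinAt_Ici hs.1) (fun s hs => ?_) _
        ⟨le_max_left _ _, le_rfl⟩
      exact Φ.norm_field_le (hM n s hs.1)
        (hC s ⟨h1.le.trans hs.1, hs.2.le.trans (max_le h2.le ht.le)⟩)
    refine (hw.add_strong hz).congr' (Eventually.of_forall fun n => ?_)
    simp
  have key : ∀ j : ℕ, j ≤ m →
      WeaklyTendsto (fun n => N n (max (τ n) (α + j * h))) (Ninf (α + j * h)) := by
    intro j
    induction j with
    | zero => intro _; simpa using hbase
    | succ j ih =>
      intro hj
      have hαj : α ≤ α + j * h := le_add_of_nonneg_right (by positivity)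
      have hlt : α + j * h < α + (j + 1 : ℕ) * h := by push_cast; linarith
      have hle : α + (j + 1 : ℕ) * h ≤ t := by
        rw [← hmh]
        gcongr
      have hβ : Tendsto (fun n => max (τ n) (α + j * h)) atTop (𝓝 (α + j * h)) := by
        simpa [max_eq_right hαj] using hτ.max (tendsto_const_nhds (x := α + j * h))
      have hstep := IsSolution.weaklyTendsto_step hlt (fun n => le_max_right (τ n) _) hβ
        (fun n => (hN n).mono (le_max_left _ _)) (hinf.mono hαj)
        (fun n s hs => hM n s ((le_max_left _ _).trans hs)) (fun s hs => hMinf s (hαj.trans hs))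
        (fun s hs => hC s ⟨by linarith [hs.1], hs.2.trans hle⟩) hC0
        (by push_cast; rw [← hK]; linarith) (ih (Nat.le_of_succ_le hj))
      refine hstep.congr' ?_
      filter_upwards [hτ.eventually_lt_const (hαj.trans_lt hlt)] with n hn
      rw [max_eq_right hn.le]
  have hfin := key m le_rfl
  rw [hmh] at hfin
  refine hfin.congr' ?_
  filter_upwards [hτ.eventually_lt_const ht] with n hn
  rw [max_eq_right hn.le]

end FeedbackSystem

end Feedback

/-! ### Smooth functions and compactness in `H^1` -/

section Smooth

variable {a b : ℝ} {E F G : Type*} [NormedAddCommGroup E] [NormedSpace ℝ E]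
  [NormedAddCommGroup F] [NormedSpace ℝ F] [NormedAddCommGroup G] [InnerProductSpace ℝ G]

/-- The restriction to `(a, b)` of a continuously differentiable function, as an element of
`H^1`. -/
def H1.ofContDiff [CompleteSpace E] (a b : ℝ) (f : ℝ → E) (hf : ContDiff ℝ 1 f) : H1 a b E :=
  ⟨WithLp.toLp 2 ((memLp_two_of_continuous hf.continuous).toLp f,
    (memLp_two_of_continuous (hf.continuous_deriv le_rfl)).toLp (deriv f)), by
    rcases lt_or_ge a b with hab | hab
    · exact ((isPrimitiveOn_of_contDiff hf a b).hasWeakDeriv hab).congr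
        (memLp_two_of_continuous hf.continuous).coeFn_toLp.symm
        (memLp_two_of_continuous (hf.continuous_deriv le_rfl)).coeFn_toLp.symm
    · intro φ _
      simp [Ioo_eq_empty hab.not_gt]⟩

theorem H1.fn_ofContDiff [CompleteSpace E] {f : ℝ → E} (hf : ContDiff ℝ 1 f) :
    (H1.ofContDiff a b f hf).fn =ᵐ[intervalMeasure a b] f :=
  (memLp_two_of_continuous hf.continuous).coeFn_toLp

theorem H1.dfn_ofContDiff [CompleteSpace E] {f : ℝ → E} (hf : ContDiff ℝ 1 f) :
    (H1.ofContDiff a b f hf).dfn =ᵐ[intervalMeasure a b] deriv f :=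
  (memLp_two_of_continuous (hf.continuous_deriv le_rfl)).coeFn_toLp

/-- A constant function, as an element of `H^1`. -/
def H1.const [CompleteSpace E] (a b : ℝ) (c : E) : H1 a b E :=
  H1.ofContDiff a b (fun _ => c) contDiff_const

theorem H1.fn_const [CompleteSpace E] (c : E) :
    (H1.const a b c).fn =ᵐ[intervalMeasure a b] fun _ => c :=
  H1.fn_ofContDiff contDiff_const

theorem H1.derivL_const [CompleteSpace E] (c : E) : H1.derivL (H1.const a b c) = 0 := by
  refine Lp.ext ?_
  filter_upwards [H1.dfn_ofContDiff (a := a) (b := b) (contDiff_const (c := c)),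
    Lp.coeFn_zero E 2 (intervalMeasure a b)] with x hx hx'
  rw [hx', H1.coeFn_derivL, H1.const, hx]
  simp

theorem tendsto_of_forall_coord {x : ℕ → E3} (h : ∀ i, Tendsto (fun n => x n i) atTop (𝓝 0)) :
    Tendsto x atTop (𝓝 0) := by
  have h1 : Tendsto (fun n => (x n).ofLp) atTop (𝓝 0) := tendsto_pi_nhds.2 fun i => by
    simpa using h i
  exact ((PiLp.continuous_toLp 2 (fun _ : Fin 3 => ℝ)).tendsto 0).comp h1

/-- Multiplication by a fixed function of `L^2` is a compact operator from `H^1` to `L^2`: weakly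
null sequences are bounded and converge to `0` pointwise, so that the dominated convergence theorem
applies. -/
theorem H1.tendsto_mulL2_zero (hab : a < b) (B : E3 →L[ℝ] F →L[ℝ] G) (f : L2 a b F)
    {x : ℕ → H1 a b E3} (hx : WeaklyTendsto x 0) :
    Tendsto (fun n => H1.mulL2 B (x n) f) atTop (𝓝 0) := by
  obtain ⟨M, hM⟩ := hx.exists_norm_le
  obtain ⟨C, hC0, hC⟩ := H1.exists_norm_eval_le a b E3
  have hpt : ∀ ω, Tendsto (fun n => H1.eval ω (x n)) atTop (𝓝 0) := fun ω =>
    tendsto_of_forall_coord fun i => by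
      simpa using hx ((EuclideanSpace.proj i).comp (H1.eval ω))
  have hnorm : ∀ n, ‖H1.mulL2 B (x n) f‖ ^ 2 =
      ∫ ω, ‖B (H1.eval ω (x n)) (f ω)‖ ^ 2 ∂(intervalMeasure a b) := by
    intro n
    rw [← real_inner_self_eq_norm_sq, L2.inner_def]
    refine integral_congr_ae ?_
    filter_upwards [H1.coeFn_mulL2 B (x n) f, ((x n).exists_isPrimitiveOn hab).2] with ω h1 h2
    rw [real_inner_self_eq_norm_sq, h1, h2]
  have hlim : Tendsto (fun n => ∫ ω, ‖B (H1.eval ω (x n)) (f ω)‖ ^ 2 ∂(intervalMeasure a b))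
      atTop (𝓝 (∫ _, (0 : ℝ) ∂(intervalMeasure a b))) := by
    refine tendsto_integral_of_dominated_convergence
      (fun ω => (‖B‖ * (C * M)) ^ 2 * ‖f ω‖ ^ 2) (fun n => ?_) ?_ (fun n => ?_) ?_
    · have := (Lp.aestronglyMeasurable (H1.mulL2 B (x n) f)).norm.pow 2
      refine this.congr ?_
      filter_upwards [H1.coeFn_mulL2 B (x n) f, ((x n).exists_isPrimitiveOn hab).2] with ω h1 h2
      simp only [Pi.pow_apply]
      rw [h1, h2]
    · exact ((Lp.memLp f).norm.integrable_sq).const_mul _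
    · refine Eventually.of_forall fun ω => ?_
      rw [Real.norm_of_nonneg (by positivity), ← mul_pow]
      have h1 : ‖H1.eval ω (x n)‖ ≤ C * M := (hC ω (x n)).trans (by gcongr; exact hM n)
      have h2 := (B.le_opNorm₂ (H1.eval ω (x n)) (f ω)).trans
        (by gcongr : _ ≤ ‖B‖ * (C * M) * ‖f ω‖)
      gcongr
    · refine Eventually.of_forall fun ω => ?_
      have h1 : Tendsto (fun n => B (H1.eval ω (x n)) (f ω)) atTop (𝓝 0) := by
        simpa [Function.comp_def] using ((B.flip (f ω)).continuous.tendsto 0).comp (hpt ω)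
      simpa using h1.norm.pow 2
  rw [tendsto_zero_iff_norm_tendsto_zero]
  have h2 : Tendsto (fun n => ‖H1.mulL2 B (x n) f‖ ^ 2) atTop (𝓝 0) := by
    simp only [hnorm]
    simpa using hlim
  have h3 := (Real.continuous_sqrt.tendsto 0).comp h2
  simpa [Function.comp_def] using h3

end Smooth

/-! ### The exponential of a bounded operator -/

section Exponential

variable {X Y : Type*} [NormedAddCommGroup X] [NormedSpace ℝ X] [CompleteSpace X]
  [NormedAddCommGroup Y] [NormedSpace ℝ Y]

/-- The flow `exp(θ P) v` of a bounded operator `P`. -/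
def expFlow (P : X →L[ℝ] X) (θ : ℝ) (v : X) : X := NormedSpace.exp (θ • P) v

theorem continuous_expFlow (P : X →L[ℝ] X) (v : X) : Continuous fun θ => expFlow P θ v := by
  let _ : NormedAlgebra ℚ (X →L[ℝ] X) := .restrictScalars ℚ ℝ _
  have h : Continuous fun θ : ℝ => NormedSpace.exp (θ • P) :=
    NormedSpace.exp_continuous.comp (continuous_id.smul continuous_const)
  exact h.clm_apply continuous_const

theorem hasSum_expFlow (P : X →L[ℝ] X) (θ : ℝ) (v : X) (L : X →L[ℝ] Y) :
    HasSum (fun k : ℕ => (k.factorial : ℝ)⁻¹ • θ ^ k • L ((P ^ k) v)) (L (expFlow P θ v)) := by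
  have h := (L.comp (ContinuousLinearMap.apply ℝ X v)).hasSum
    (NormedSpace.exp_series_hasSum_exp' (𝕂 := ℝ) (θ • P))
  refine h.congr_fun fun k => ?_
  simp [smul_pow]

end Exponential

/-! ### The rotating frame -/

section Frame

variable {a b : ℝ}

/-- The wedge product as a continuous bilinear map. -/
def wedgeL : E3 →L[ℝ] E3 →L[ℝ] E3 :=
  (LinearMap.mk₂ ℝ wedge
    (fun v v' w => by simp [wedge]) (fun c v w => by simp [wedge])
    (fun v w w' => by simp [wedge]) (fun c v w => by simp [wedge])).toContinuousBilinearMap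

theorem wedgeL_apply (v w : E3) : wedgeL v w = wedge v w := rfl

/-- The action of matrices on vectors as a continuous bilinear map. -/
def actL : Mat3 →L[ℝ] E3 →L[ℝ] E3 :=
  (LinearMap.mk₂ ℝ act
    (fun v v' w => by simp [act, Matrix.add_mulVec])
    (fun c v w => by simp [act, Matrix.smul_mulVec])
    (fun v w w' => by simp [act, Matrix.mulVec_add])
    (fun c v w => by simp [act, Matrix.mulVec_smul])).toContinuousBilinearMap

theorem actL_apply (A : Mat3) (v : E3) : actL A v = act A v := rfl

theorem inner_wedge_self_right (v w : E3) : inner ℝ w (wedge v w) = 0 := by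
  rw [wedge, ← real_inner_comm, EuclideanSpace.inner_eq_star_dotProduct]
  simp [dot_cross_self]

/-- The operator on `H^1` that multiplies `M(ω)` by `ω S` on the right. -/
def mulS (a b : ℝ) : H1 a b Mat3 →L[ℝ] H1 a b Mat3 :=
  (H1.bilin (ContinuousLinearMap.mul ℝ Mat3)).flip
    (H1.ofContDiff a b (fun ω => ω • S) (contDiff_id.smul contDiff_const))

theorem fn_mulS (M : H1 a b Mat3) :
    (mulS a b M).fn =ᵐ[intervalMeasure a b] fun ω => M.fn ω * (ω • S) := by
  have hc : ContDiff ℝ 1 fun ω : ℝ => ω • S := contDiff_id.smul contDiff_const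
  filter_upwards [H1.fn_bilin (ContinuousLinearMap.mul ℝ Mat3) M (H1.ofContDiff a b _ hc),
    H1.fn_ofContDiff (a := a) (b := b) hc] with ω h1 h2
  rw [h2] at h1
  exact h1

theorem fn_mulS_pow (M : H1 a b Mat3) (k : ℕ) :
    ((mulS a b ^ k) M).fn =ᵐ[intervalMeasure a b] fun ω => M.fn ω * (ω • S) ^ k := by
  induction k with
  | zero => simp
  | succ k ih =>
    rw [pow_succ']
    filter_upwards [ih, fn_mulS ((mulS a b ^ k) M)] with ω h1 h2
    rw [pow_succ, ← mul_assoc, ← h1]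
    exact h2

/-- `F(t, ·)` as an element of `H^1`. It is obtained from `R` by the exponential of the bounded
operator `σ(t) mulS`, which makes its continuity in `t` evident. -/
def frame (T : ℝ) (R : H1 a b Mat3) (t : ℝ) : H1 a b Mat3 :=
  expFlow (mulS a b) (sigma T t) R

theorem fn_frame (hab : a < b) (T : ℝ) (R : H1 a b Mat3) (t : ℝ) :
    (frame T R t).fn =ᵐ[intervalMeasure a b] F T R t := by
  have hk : ∀ᵐ ω ∂(intervalMeasure a b), ∀ k : ℕ,
      H1.eval ω ((mulS a b ^ k) R) = R.fn ω * (ω • S) ^ k := by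
    rw [ae_all_iff]
    intro k
    filter_upwards [fn_mulS_pow R k, (((mulS a b ^ k) R).exists_isPrimitiveOn hab).2] with ω h1 h2
    rw [← h1, h2]
  filter_upwards [hk, ((frame T R t).exists_isPrimitiveOn hab).2] with ω h1 h2
  rw [h2, F, mul_smul]
  have s1 := hasSum_expFlow (mulS a b) (sigma T t) R (H1.eval ω)
  have s2 : HasSum (fun k : ℕ => R.fn ω * ((k.factorial : ℝ)⁻¹ • (sigma T t • ω • S) ^ k))
      (R.fn ω * NormedSpace.exp (sigma T t • ω • S)) :=
    (NormedSpace.exp_series_hasSum_exp' (𝕂 := ℝ) (sigma T t • ω • S)).mul_left _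
  simp only [h1] at s1
  simp only [smul_pow (sigma T t), mul_smul_comm] at s2
  exact s1.unique s2

theorem dF_ae_eq (hab : a < b) (T : ℝ) (R : H1 a b Mat3) (t : ℝ) :
    dF T R t =ᵐ[intervalMeasure a b] (frame T R t).dfn :=
  (frame T R t).weakDeriv_ae_eq (fn_frame hab T R t).symm

theorem continuous_sigma (T : ℝ) : Continuous (sigma T) := by
  refine intervalIntegral.continuous_primitive (fun x y => ?_) 0
  have hm : Measurable (eps T) :=
    (measurable_from_top (f := fun n : ℤ => (-1 : ℝ) ^ n)).comp
      (Int.measurable_floor.comp (measurable_id.div_const T))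
  refine (intervalIntegrable_const (c := (1 : ℝ))).mono_fun hm.aestronglyMeasurable
    (Eventually.of_forall fun s => ?_)
  simp [eps]

theorem continuous_frame (T : ℝ) (R : H1 a b Mat3) : Continuous (frame T R) :=
  (continuous_expFlow (mulS a b) R).comp (continuous_sigma T)

/-- The column `F(t, ·) e_i`, as an element of `H^1`. -/
def column (T : ℝ) (R : H1 a b Mat3) (i : Fin 2) (t : ℝ) : H1 a b E3 :=
  H1.bilin actL (frame T R t) (H1.const a b (e i.castSucc))

theorem continuous_column (T : ℝ) (R : H1 a b Mat3) (i : Fin 2) : Continuous (column T R i) :=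
  ((H1.bilin actL).flip (H1.const a b (e i.castSucc))).continuous.comp (continuous_frame T R)

theorem fn_column (hab : a < b) (T : ℝ) (R : H1 a b Mat3) (i : Fin 2) (t : ℝ) :
    (column T R i t).fn =ᵐ[intervalMeasure a b] fun ω => act (F T R t ω) (e i.castSucc) := by
  filter_upwards [H1.fn_bilin actL (frame T R t) (H1.const a b (e i.castSucc)),
    fn_frame hab T R t, H1.fn_const (a := a) (b := b) (e i.castSucc)] with ω h1 h2 h3
  rw [column, h1, h2, h3, actL_apply]

theorem dfn_column (hab : a < b) (T : ℝ) (R : H1 a b Mat3) (i : Fin 2) (t : ℝ) :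
    (column T R i t).dfn =ᵐ[intervalMeasure a b] fun ω => act (dF T R t ω) (e i.castSucc) := by
  have h : H1.derivL (column T R i t) =
      H1.mulL2 actL.flip (H1.const a b (e i.castSucc)) (H1.derivL (frame T R t)) := by
    rw [column, H1.derivL_bilin, H1.derivL_const, map_zero, add_zero]
  filter_upwards [H1.coeFn_mulL2 actL.flip (H1.const a b (e i.castSucc))
    (H1.derivL (frame T R t)), dF_ae_eq hab T R t,
    H1.fn_const (a := a) (b := b) (e i.castSucc)] with ω h1 h2 h3
  rw [← H1.coeFn_derivL, h, h1, h3, h2, H1.coeFn_derivL, ContinuousLinearMap.flip_apply,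
    actL_apply]

end Frame

/-! ### The closed loop system as a feedback system -/

section Forms

variable {X Y Z : Type*} [NormedAddCommGroup X] [NormedSpace ℝ X] [NormedAddCommGroup Y]
  [InnerProductSpace ℝ Y] [NormedAddCommGroup Z] [NormedSpace ℝ Z]

/-- The real inner product as a continuous bilinear map. -/
def innerL (Y : Type*) [NormedAddCommGroup Y] [InnerProductSpace ℝ Y] : Y →L[ℝ] Y →L[ℝ] ℝ :=
  (isBoundedBilinearMap_inner (𝕜 := ℝ) (E := Y)).toContinuousLinearMap

/-- The bilinear form `(x, y) ↦ -⟨W(x, f), D y⟩`, as a continuous linear function of `f`. -/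
def pairingForm (D : X →L[ℝ] Y) (W : X →L[ℝ] Z →L[ℝ] Y) : Z →L[ℝ] X →L[ℝ] X →L[ℝ] ℝ :=
  (ContinuousLinearMap.compL ℝ X Y (X →L[ℝ] ℝ)
    (-((ContinuousLinearMap.compL ℝ X Y ℝ).flip D).comp (innerL Y))).comp W.flip

theorem tendsto_pairingForm (D : X →L[ℝ] Y) (W : X →L[ℝ] Z →L[ℝ] Y) (f : Z) {x : ℕ → X}
    (hx : Tendsto (fun n => W (x n) f) atTop (𝓝 0)) :
    Tendsto (fun n => pairingForm D W f (x n)) atTop (𝓝 0) := by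
  have h := ((-((ContinuousLinearMap.compL ℝ X Y ℝ).flip D).comp (innerL Y)).continuous.tendsto
    0).comp hx
  rw [map_zero] at h
  exact h

end Forms

section System

variable {a b : ℝ}

/-- The linear form `x ↦ ∫ ⟨e_3, x⟩`. -/
def heightForm (a b : ℝ) : H1 a b E3 →L[ℝ] ℝ :=
  (innerL (L2 a b E3) (H1.toL2L (H1.const a b (e 2)))).comp H1.toL2L

theorem heightForm_apply (x : H1 a b E3) :
    heightForm a b x = inner ℝ (H1.toL2L (H1.const a b (e 2))) (H1.toL2L x) := rfl

theorem continuous_wedge_column (T : ℝ) (R : H1 a b Mat3) (i : Fin 2) :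
    Continuous fun t => H1.bilin wedgeL (column T R i t) :=
  (H1.bilin (a := a) (b := b) wedgeL).continuous.comp (continuous_column T R i)

/-- The bilinear form `(x, y) ↦ -∫ ⟨g' ∧ x, y'⟩`, the quadratic part of the feedback law for the
column `g`. -/
def torqueForm (a b : ℝ) (g : H1 a b E3) : H1 a b E3 →L[ℝ] H1 a b E3 →L[ℝ] ℝ :=
  pairingForm (H1.derivL (a := a) (b := b) (E := E3)) (H1.mulL2 wedgeL.flip) (H1.derivL g)

theorem continuous_torqueForm : Continuous (torqueForm a b) :=
  (pairingForm (H1.derivL (a := a) (b := b) (E := E3)) (H1.mulL2 wedgeL.flip)).continuous.comp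
    (H1.derivL (a := a) (b := b) (E := E3)).continuous

theorem tendsto_torqueForm (hab : a < b) (g : H1 a b E3) {x : ℕ → H1 a b E3}
    (hx : WeaklyTendsto x 0) : Tendsto (fun n => torqueForm a b g (x n)) atTop (𝓝 0) :=
  tendsto_pairingForm (H1.derivL (a := a) (b := b) (E := E3)) (H1.mulL2 wedgeL.flip) (H1.derivL g)
    (H1.tendsto_mulL2_zero hab wedgeL.flip (H1.derivL g) hx)

/-- The closed loop system in the form of an abstract feedback system on `H^1`. -/
def blochSystem (hab : a < b) (T : ℝ) (R : H1 a b Mat3) : FeedbackSystem (Fin 2) (H1 a b E3) where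
  A i t := H1.bilin wedgeL (column T R i t)
  p i t := torqueForm a b (column T R i t)
  l i t := (-heightForm a b).comp (H1.bilin wedgeL (column T R i t))
  continuous_A i := continuous_wedge_column T R i
  continuous_p i := continuous_torqueForm.comp (continuous_column T R i)
  continuous_l i := continuous_const.clm_comp (continuous_wedge_column T R i)
  compact i t _ hx := tendsto_torqueForm hab (column T R i t) hx

theorem control_blochSystem (hab : a < b) (T : ℝ) (R : H1 a b Mat3) (i : Fin 2) (t : ℝ)
    (x : H1 a b E3) : (blochSystem hab T R).control i t x =
      -inner ℝ (H1.mulL2 wedgeL.flip x (H1.derivL (column T R i t))) (H1.derivL x) +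
        -inner ℝ (H1.toL2L (H1.const a b (e 2)))
          (H1.mulL2 wedgeL (column T R i t) (H1.toL2L x)) := rfl

theorem u_eq_control (hab : a < b) (T : ℝ) (R : H1 a b Mat3) (i : Fin 2) (t : ℝ)
    (N : H1 a b E3) : u T R i t N = (blochSystem hab T R).control i t N := by
  rw [control_blochSystem, ← neg_add, u, H, L2.inner_def, L2.inner_def,
    ← integral_add (L2.integrable_inner _ _) (L2.integrable_inner _ _)]
  congr 1
  refine integral_congr_ae ?_
  filter_upwards [H1.coeFn_mulL2 wedgeL.flip N (H1.derivL (column T R i t)),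
    H1.coeFn_mulL2 wedgeL (column T R i t) (H1.toL2L N), dfn_column hab T R i t,
    fn_column hab T R i t, H1.fn_const (a := a) (b := b) (e 2)] with ω k1 k2 k3 k4 k5
  rw [k1, k2, H1.coeFn_derivL, H1.coeFn_derivL, H1.coeFn_toL2L, H1.coeFn_toL2L, k3, k4, k5,
    ContinuousLinearMap.flip_apply, wedgeL_apply, wedgeL_apply, real_inner_comm (N.dfn ω)]

/-- The equation, given pointwise almost everywhere, is an equation in `H^1`, since an element of
`H^1` is determined by its values almost everywhere. -/
theorem IsClosedLoopSolution.isSolution (hab : a < b) {T : ℝ} {R : H1 a b Mat3} {τ : ℝ}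
    {N0 : H1 a b E3} {N : ℝ → H1 a b E3} (h : IsClosedLoopSolution T R τ N0 N) :
    (blochSystem hab T R).IsSolution τ N := by
  intro t ht
  have hd := (h.contDiffOn.differentiableOn one_ne_zero t ht).hasDerivWithinAt
  refine hd.congr_deriv (H1.ext_ae ?_)
  have hA : ∀ i : Fin 2, ((blochSystem hab T R).A i t (N t)).fn =ᵐ[intervalMeasure a b]
      fun ω => wedge (act (F T R t ω) (e i.castSucc)) ((N t).fn ω) := by
    intro i
    filter_upwards [H1.fn_bilin wedgeL (column T R i t) (N t), fn_column hab T R i t]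
      with ω h1 h2
    rw [← h2]
    exact h1
  set c := fun i => (blochSystem hab T R).control i t (N t) with hc
  set v := fun i => (blochSystem hab T R).A i t (N t) with hv
  have hfield : H1.toL2L ((blochSystem hab T R).field t (N t)) =
      c 0 • H1.toL2L (v 0) + c 1 • H1.toL2L (v 1) := by
    rw [FeedbackSystem.field, Fin.sum_univ_two, map_add, map_smul, map_smul]
  rw [← H1.coeFn_toL2L ((blochSystem hab T R).field t (N t)), hfield]
  filter_upwards [h.equation t ht, hA 0, hA 1, Lp.coeFn_add (c 0 • H1.toL2L (v 0))
    (c 1 • H1.toL2L (v 1)), Lp.coeFn_smul (c 0) (H1.toL2L (v 0)),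
    Lp.coeFn_smul (c 1) (H1.toL2L (v 1))] with ω k1 k2 k3 k4 k5 k6
  rw [k1, k4, Pi.add_apply, k5, k6, Pi.smul_apply, Pi.smul_apply, H1.coeFn_toL2L, H1.coeFn_toL2L,
    k2, k3, Fin.sum_univ_two, u_eq_control hab, u_eq_control hab]

/-! ### Conserved and decreasing quantities -/

theorem inner_mulL2_wedge_self (g : H1 a b E3) (f : L2 a b E3) :
    inner ℝ f (H1.mulL2 wedgeL g f) = 0 := by
  rw [L2.inner_def]
  refine integral_eq_zero_of_ae ?_
  filter_upwards [H1.coeFn_mulL2 wedgeL g f] with ω h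
  rw [h, wedgeL_apply, inner_wedge_self_right, Pi.zero_apply]

/-- The `L²` norm is constant along the solutions. -/
theorem norm_toL2L_eq (hab : a < b) {T : ℝ} {R : H1 a b Mat3} {τ : ℝ} {N : ℝ → H1 a b E3}
    (h : (blochSystem hab T R).IsSolution τ N) {t : ℝ} (ht : τ ≤ t) :
    ‖H1.toL2L (N t)‖ = ‖H1.toL2L (N τ)‖ := by
  have hd : ∀ s ∈ Ici τ, HasDerivWithinAt (fun s => ‖H1.toL2L (N s)‖ ^ 2) 0 (Ici τ) s := by
    intro s hs
    have h1 := (H1.toL2L.hasFDerivAt.comp_hasDerivWithinAt s (h s hs)).norm_sq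
    refine h1.congr_deriv ?_
    have : ∀ i, inner ℝ (H1.toL2L (N s)) (H1.toL2L ((blochSystem hab T R).A i s (N s))) = 0 :=
      fun i => inner_mulL2_wedge_self (column T R i s) (H1.toL2L (N s))
    simp only [Function.comp_apply, FeedbackSystem.field, map_sum, map_smul, inner_sum,
      inner_smul_right, this]
    simp
  have := constant_of_has_deriv_right_zero (a := τ) (b := t)
    (fun s hs => ((hd s hs.1).mono Icc_subset_Ici_self).continuousWithinAt)
    (fun s hs => (hd s hs.1).mono (Ici_subset_Ici.2 hs.1)) t ⟨ht, le_rfl⟩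
  exact (sq_eq_sq₀ (norm_nonneg _) (norm_nonneg _)).1 this

/-- The Lyapunov function `½ ∫ |N'|² + ∫ ⟨e_3, N⟩` of the closed loop system. -/
def energy (x : H1 a b E3) : ℝ :=
  1 / 2 * ‖H1.derivL x‖ ^ 2 + heightForm a b x

/-- The energy decreases along the solutions: its derivative is `∑ i, u_i H_i = -∑ i, u_i²`. -/
theorem energy_le (hab : a < b) {T : ℝ} {R : H1 a b Mat3} {τ : ℝ} {N : ℝ → H1 a b E3}
    (h : (blochSystem hab T R).IsSolution τ N) {t : ℝ} (ht : τ ≤ t) :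
    energy (N t) ≤ energy (N τ) := by
  have hd : ∀ s ∈ Ici τ, HasDerivWithinAt (fun s => energy (N s))
      (-∑ i, (blochSystem hab T R).control i s (N s) ^ 2) (Ici τ) s := by
    intro s hs
    have h1 := (H1.derivL.hasFDerivAt.comp_hasDerivWithinAt s (h s hs)).norm_sq.const_mul (1 / 2)
    have h2 := (heightForm a b).hasFDerivAt.comp_hasDerivWithinAt s (h s hs)
    refine (h1.add h2).congr_deriv ?_
    have key : ∀ i, inner ℝ (H1.derivL (N s)) (H1.derivL ((blochSystem hab T R).A i s (N s))) +
        heightForm a b ((blochSystem hab T R).A i s (N s)) =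
          -(blochSystem hab T R).control i s (N s) := by
      intro i
      have e1 : H1.derivL ((blochSystem hab T R).A i s (N s)) =
          H1.mulL2 wedgeL.flip (N s) (H1.derivL (column T R i s)) +
            H1.mulL2 wedgeL (column T R i s) (H1.derivL (N s)) := rfl
      have e2 : heightForm a b ((blochSystem hab T R).A i s (N s)) =
          inner ℝ (H1.toL2L (H1.const a b (e 2)))
            (H1.mulL2 wedgeL (column T R i s) (H1.toL2L (N s))) := rfl
      rw [e1, e2, control_blochSystem, inner_add_right, inner_mulL2_wedge_self,
        real_inner_comm (H1.derivL (N s))]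
      ring
    simp only [Function.comp_apply, FeedbackSystem.field, map_sum, map_smul, inner_sum,
      inner_smul_right, smul_eq_mul]
    rw [← mul_assoc, show (1 / 2 : ℝ) * 2 = 1 by norm_num, one_mul, ← Finset.sum_add_distrib,
      ← Finset.sum_neg_distrib]
    refine Finset.sum_congr rfl fun i _ => ?_
    rw [← mul_add, key]
    ring
  refine image_le_of_deriv_right_le_deriv_boundary (a := τ) (b := t)
    (f := fun s => energy (N s)) (B := fun _ => energy (N τ)) (B' := fun _ => 0)
    (fun s hs => ((hd s hs.1).mono Icc_subset_Ici_self).continuousWithinAt)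
    (fun s hs => (hd s hs.1).mono (Ici_subset_Ici.2 hs.1)) le_rfl continuousOn_const
    (fun s _ => hasDerivWithinAt_const s _ _)
    (fun s _ => neg_nonpos.2 (Finset.sum_nonneg fun i _ => sq_nonneg _)) ⟨ht, le_rfl⟩

/-- The solutions remain bounded in `H^1`, uniformly for bounded initial states. -/
theorem exists_norm_le_of_isSolution (hab : a < b) (T : ℝ) (R : H1 a b Mat3) (M₀ : ℝ) :
    ∃ M, ∀ τ (N : ℝ → H1 a b E3), (blochSystem hab T R).IsSolution τ N → ‖N τ‖ ≤ M₀ →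
      ∀ t ≥ τ, ‖N t‖ ≤ M := by
  set c := ‖H1.toL2L (H1.const a b (e 2))‖ with hc
  refine ⟨√(2 * M₀ ^ 2 + 4 * c * M₀), fun τ N h h0 t ht => Real.le_sqrt_of_sq_le ?_⟩
  have e1 := norm_toL2L_eq hab h ht
  have e2 := energy_le hab h ht
  have n0 := H1.norm_sq_eq (N τ)
  have n1 := H1.norm_sq_eq (N t)
  have hM0 : ‖N τ‖ ^ 2 ≤ M₀ ^ 2 := by gcongr
  have hm : ‖H1.toL2L (N τ)‖ ≤ M₀ := by
    refine le_trans (le_of_sq_le_sq ?_ (norm_nonneg _)) h0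
    nlinarith [sq_nonneg ‖H1.derivL (N τ)‖]
  have hi0 := (real_inner_le_norm (H1.toL2L (H1.const a b (e 2))) (H1.toL2L (N τ)))
  have hi1 := (abs_le.1 (abs_real_inner_le_norm (H1.toL2L (H1.const a b (e 2)))
    (H1.toL2L (N t)))).1
  have hcm : c * ‖H1.toL2L (N τ)‖ ≤ c * M₀ := by gcongr
  simp only [energy, heightForm_apply] at e2
  rw [e1] at n1 hi1
  nlinarith [sq_nonneg ‖H1.toL2L (N τ)‖]

end System

end

end BlochEnsemble

open BlochEnsemble
theorem proposition4 (a b T : ℝ) (hab : a < b) (hT : 0 < T)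
    (M_f : H1 a b E3) (hM_f : SphereValued M_f)
    (R : H1 a b Mat3) (hR : RotationValued R)
    (hRM : ∀ᵐ ω ∂(intervalMeasure a b), act (R.fn ω) (M_f.fn ω) = -e 2)
    (N0 : ℕ → H1 a b E3) (hN0 : ∀ n, SphereValued (N0 n))
    (N0_inf : H1 a b E3) (hN0_inf : SphereValued N0_inf)
    (hweak : WeaklyTendsto N0 N0_inf)
    (hstrong : Tendsto (fun n => (N0 n).toL2) atTop (𝓝 N0_inf.toL2))
    (α : ℝ) (hα : α ∈ Icc 0 (2 * T))
    (τ : ℕ → ℝ) (hτ : ∀ n, τ n ∈ Ico 0 (2 * T)) (hτα : Tendsto τ atTop (𝓝 α))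
    (N : ℕ → ℝ → H1 a b E3)
    (hN : ∀ n, IsClosedLoopSolution T R (τ n) (N0 n) (N n))
    (N_inf : ℝ → H1 a b E3)
    (hN_inf : IsClosedLoopSolution T R α N0_inf N_inf) :
    (∀ t > α, WeaklyTendsto (fun n => N n t) (N_inf t)) ∧
      ∀ t > α, ∀ j : Fin 2,
        Tendsto (fun n => u T R j t (N n t)) atTop (𝓝 (u T R j t (N_inf t))) := by
  obtain ⟨M₀, hM₀⟩ := hweak.exists_norm_le
  obtain ⟨M, hM⟩ := exists_norm_le_of_isSolution hab T R (max M₀ ‖N0_inf‖)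
  have hsol : ∀ n, (blochSystem hab T R).IsSolution (τ n) (N n) := fun n => (hN n).isSolution hab
  have hsol' : (blochSystem hab T R).IsSolution α N_inf := hN_inf.isSolution hab
  have hinit : WeaklyTendsto (fun n => N n (τ n)) (N_inf α) := by
    simpa only [(hN _).initial, hN_inf.initial] using hweak
  have key : ∀ t > α, WeaklyTendsto (fun n => N n t) (N_inf t) := fun t ht =>
    FeedbackSystem.IsSolution.weaklyTendsto hτα hsol hsol'
      (fun n => hM _ _ (hsol n) (by rw [(hN n).initial]; exact (hM₀ n).trans (le_max_left _ _)))
      (hM _ _ hsol' (by rw [hN_inf.initial]; exact le_max_right _ _)) hinit ht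
  refine ⟨key, fun t ht j => ?_⟩
  simp only [u_eq_control hab]
  exact (blochSystem hab T R).tendsto_control (key t ht)
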